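/- Consider first-order logic (FO) with equality over a relational vocabulary that has countably many predicates of each arity and no function symbols or constants. FO$^2$ is the set of FO-formulas that use only two fixed variables $x,y$ (free or bound) and only predicates of arity one and two. For a formula $\varphi$, $\mathrm{sig}(\varphi)$ is the set of predicates occurring in $\varphi$ (equality is not a predicate), and a signature is a finite set of predicates. Let $F$ be a fragment of FO, that is, a set of FO-formulas, let $\varphi_1,\varphi_2$ be $F$-sentences and $\Sigma$ a signature. We say that * $\varphi_1$ *$\Sigma$-entails* $\varphi_2$ (in $F$) if for all sentences $\psi\in F$ with $\mathrm{sig}(\psi)\subseteq\Sigma$, $\varphi_2\models\psi$ implies $\varphi_1\models\psi$; * $\varphi_1$ and $\varphi_2$ are *$\Sigma$-inseparable* (in $F$) if each $\Sigma$-entails the other; * $\varphi_1\wedge\varphi_2$ is a *conservative extension* of $\varphi_1$ (in $F$) if $\varphi_1$ $\mathrm{sig}(\varphi_1)$-entails $\varphi_1\wedge\varphi_2$; * $\varphi_1$ *strongly $\Sigma$-entails* $\varphi_2$ (in $F$) if $\varphi_1$ $\Sigma'$-entails $\varphi_2$ for every signature $\Sigma'$ with $\Sigma'\cap\mathrm{sig}(\varphi_2)\subseteq\Sigma$.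 **Theorem.** Let $F$ be any fragment of FO that contains FO$^2$. Then the following four problems are undecidable: given $F$-sentences $\varphi_1,\varphi_2$, decide whether $\varphi_1\wedge\varphi_2$ is a conservative extension of $\varphi_1$ in $F$; given in addition a signature $\Sigma$, decide whether $\varphi_1,\varphi_2$ are $\Sigma$-inseparable in $F$; whether $\varphi_1$ $\Sigma$-entails $\varphi_2$ in $F$; whether $\varphi_1$ strongly $\Sigma$-entails $\varphi_2$ in $F$. (Undecidable means that no algorithm halts with the correct answer on all inputs of the stated form; the behaviour on other inputs is irrelevant.) Moreover, FO$^2$-conservative extensions of $\mathcal{ALC}$-TBoxes are undecidable: there is no algorithm that decides, given two $\mathcal{ALC}$-TBoxes $\mathcal T_1,\mathcal T_2$ (finite sets of concept inclusions), whether every FO$^2$-sentence $\psi$ that uses only concept and role names occurring in $\mathcal T_1$ (as unary and binary predicates) and satisfies $\mathcal T_1\cup\mathcal T_2\models\psi$ also satisfies $\mathcal T_1\models\psi$. -/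

import Mathlib

namespace FOFrag

/-- The purely relational vocabulary: no function symbols or constants, and for every arity a
countably infinite supply of predicates, indexed by the natural numbers. -/
def predLang : FirstOrder.Language.{0, 0} where
  Functions _ := Empty
  Relations _ := ℕ

/-- A predicate, given as a pair (index, arity). -/
abbrev Predicate := ℕ × ℕ

/-- Formulas of first-order logic with equality and predicates over the named variables
`0, 1, 2, …`. The atom `rel R xs` is built from the predicate with index `R` and arity `xs.length`.
The other connectives and the universal quantifier are the usual abbreviations. -/
inductive Formula : Type
  | eq (x y : ℕ) : Formula
  | rel (R : ℕ) (xs : List ℕ) : Formula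
  | neg (φ : Formula) : Formula
  | and (φ ψ : Formula) : Formula
  | ex (x : ℕ) (φ : Formula) : Formula

namespace Formula

/-- Goedel numbering of formulas. -/
def toNat : Formula → ℕ
  | eq x y => 5 * Nat.pair x y
  | rel R xs => 5 * Nat.pair R (Encodable.encode xs) + 1
  | neg φ => 5 * φ.toNat + 2
  | and φ ψ => 5 * Nat.pair φ.toNat ψ.toNat + 3
  | ex x φ => 5 * Nat.pair x φ.toNat + 4

/-- The formula with a given Goedel number. -/
def ofNat (n : ℕ) : Formula :=
  if h0 : n % 5 = 0 then eq (n / 5).unpair.1 (n / 5).unpair.2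
  else if n % 5 = 1 then
    rel (n / 5).unpair.1 (Denumerable.ofNat (List ℕ) (n / 5).unpair.2)
  else
    have h : n / 5 < n := by omega
    have h1 : (n / 5).unpair.1 < n := lt_of_le_of_lt (Nat.unpair_left_le _) h
    have h2 : (n / 5).unpair.2 < n := lt_of_le_of_lt (Nat.unpair_right_le _) h
    if n % 5 = 2 then neg (ofNat (n / 5))
    else if n % 5 = 3 then and (ofNat (n / 5).unpair.1) (ofNat (n / 5).unpair.2)
    else ex (n / 5).unpair.1 (ofNat (n / 5).unpair.2)
  termination_by n

theorem ofNat_toNat (φ : Formula) : ofNat φ.toNat = φ := by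
  induction φ with
  | eq x y =>
    rw [toNat, ofNat, dif_pos (by omega)]
    simp
  | rel R xs =>
    rw [toNat, ofNat, dif_neg (by omega), if_pos (by omega)]
    have : (5 * Nat.pair R (Encodable.encode xs) + 1) / 5 = Nat.pair R (Encodable.encode xs) := by
      omega
    rw [this]
    simp
  | neg φ ih =>
    rw [toNat, ofNat, dif_neg (by omega), if_neg (by omega)]
    have : (5 * φ.toNat + 2) / 5 = φ.toNat := by omega
    simp [this, ih]
  | and φ ψ ih1 ih2 =>
    rw [toNat, ofNat, dif_neg (by omega), if_neg (by omega)]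
    have : (5 * Nat.pair φ.toNat ψ.toNat + 3) / 5 = Nat.pair φ.toNat ψ.toNat := by omega
    simp [this, ih1, ih2]
  | ex x φ ih =>
    rw [toNat, ofNat, dif_neg (by omega), if_neg (by omega)]
    have : (5 * Nat.pair x φ.toNat + 4) / 5 = Nat.pair x φ.toNat := by omega
    simp [this, ih]

theorem toNat_ofNat (n : ℕ) : (ofNat n).toNat = n := by
  induction n using Nat.strong_induction_on with
  | _ n ih =>
    rw [ofNat]
    have e1 : Nat.pair (n / 5).unpair.1 (n / 5).unpair.2 = n / 5 := Nat.pair_unpair _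
    by_cases h0 : n % 5 = 0
    · rw [dif_pos h0, toNat, e1]
      omega
    · rw [dif_neg h0]
      have h : n / 5 < n := by omega
      have h1 : (n / 5).unpair.1 < n := lt_of_le_of_lt (Nat.unpair_left_le _) h
      have h2 : (n / 5).unpair.2 < n := lt_of_le_of_lt (Nat.unpair_right_le _) h
      split_ifs with a b c
      · rw [toNat, Denumerable.encode_ofNat, e1]
        omega
      · rw [toNat, ih _ h]
        omega
      · rw [toNat, ih _ h1, ih _ h2, e1]
        omega
      · rw [toNat, ih _ h2, e1]
        omega

def equivNat : Formula ≃ ℕ := ⟨toNat, ofNat, ofNat_toNat, toNat_ofNat⟩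

instance : Primcodable Formula := Primcodable.ofEquiv ℕ equivNat

/-- All variables that occur in a formula, free or bound. -/
def vars : Formula → Finset ℕ
  | eq x y => {x, y}
  | rel _ xs => xs.toFinset
  | neg φ => φ.vars
  | and φ ψ => φ.vars ∪ ψ.vars
  | ex x φ => insert x φ.vars

def freeVars : Formula → Finset ℕ
  | eq x y => {x, y}
  | rel _ xs => xs.toFinset
  | neg φ => φ.freeVars
  | and φ ψ => φ.freeVars ∪ ψ.freeVars
  | ex x φ => φ.freeVars.erase x

def IsSentence (φ : Formula) : Prop := φ.freeVars = ∅

/-- The set of predicates that occur in a formula; equality is not a predicate. -/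
def sig : Formula → Finset Predicate
  | eq _ _ => ∅
  | rel R xs => {(R, xs.length)}
  | neg φ => φ.sig
  | and φ ψ => φ.sig ∪ ψ.sig
  | ex _ φ => φ.sig

/-- Truth of a formula in the structure with domain `A` under the assignment `v`. -/
def Holds {A : Type} [predLang.Structure A] (v : ℕ → A) : Formula → Prop
  | eq x y => v x = v y
  | rel R xs =>
      FirstOrder.Language.Structure.RelMap (L := predLang) (n := xs.length) R
        (fun i => v (xs.get i))
  | neg φ => ¬ φ.Holds v
  | and φ ψ => φ.Holds v ∧ ψ.Holds v
  | ex x φ => ∃ a : A, φ.Holds (Function.update v x a)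

/-- Logical consequence. Domains are non-empty since they carry an assignment; restricting them to
`Type` is harmless by the downward Loewenheim-Skolem theorem. -/
def Consequence (φ ψ : Formula) : Prop :=
  ∀ (A : Type) [predLang.Structure A] (v : ℕ → A), φ.Holds v → ψ.Holds v

end Formula

/-- The two-variable fragment: only the variables `0` and `1` occur (free or bound), and all
predicates are unary or binary; equality is admitted. -/
def FO2 : Set Formula :=
  {φ | φ.vars ⊆ {0, 1} ∧ ∀ P ∈ φ.sig, P.2 = 1 ∨ P.2 = 2}

/-- `φ₁` `S`-entails `φ₂`, with respect to the fragment `F`. -/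
def SigEntails (F : Set Formula) (S : Finset Predicate) (φ₁ φ₂ : Formula) : Prop :=
  ∀ ψ ∈ F, ψ.IsSentence → ψ.sig ⊆ S → φ₂.Consequence ψ → φ₁.Consequence ψ

def SigInseparable (F : Set Formula) (S : Finset Predicate) (φ₁ φ₂ : Formula) : Prop :=
  SigEntails F S φ₁ φ₂ ∧ SigEntails F S φ₂ φ₁

/-- `φ₁ ∧ φ₂` is a conservative extension of `φ₁`, with respect to the fragment `F`. -/
def ConservativeExt (F : Set Formula) (φ₁ φ₂ : Formula) : Prop :=
  SigEntails F φ₁.sig φ₁ (φ₁.and φ₂)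

def StronglySigEntails (F : Set Formula) (S : Finset Predicate) (φ₁ φ₂ : Formula) : Prop :=
  ∀ S' : Finset Predicate, S' ∩ φ₂.sig ⊆ S → SigEntails F S' φ₁ φ₂

/-- `φ` is an `F`-sentence. -/
def IsSentenceOf (F : Set Formula) (φ : Formula) : Prop := φ ∈ F ∧ φ.IsSentence

/-- The problem "given an input `a` with `D a`, decide whether `P a`" is decidable: some algorithm
halts with the correct answer on every input that satisfies `D`; nothing is required of it on other
inputs. -/
def DecidableOn {α : Type} [Primcodable α] (D P : α → Prop) : Prop :=
  ∃ f : α →. Bool, Partrec f ∧ ∀ a, D a → ∃ b ∈ f a, (b = true ↔ P a)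

/-- Concepts of the description logic ALC. Concept names are unary predicates and role names are
binary predicates. The constructors `⊥`, `⊔`, `∀ r.C` are the usual abbreviations. -/
inductive Concept : Type
  | top : Concept
  | name (A : ℕ) : Concept
  | neg (C : Concept) : Concept
  | inf (C D : Concept) : Concept
  | ex (r : ℕ) (C : Concept) : Concept

namespace Concept

/-- Goedel numbering of concepts. -/
def toNat : Concept → ℕ
  | top => 0
  | name A => 4 * A + 1
  | neg C => 4 * C.toNat + 2
  | inf C D => 4 * Nat.pair C.toNat D.toNat + 3
  | ex r C => 4 * Nat.pair r C.toNat + 4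

/-- The concept with a given Goedel number. -/
def ofNat : ℕ → Concept
  | 0 => top
  | n + 1 =>
    have h : n / 4 < n + 1 := by omega
    have h1 : (n / 4).unpair.1 < n + 1 := lt_of_le_of_lt (Nat.unpair_left_le _) h
    have h2 : (n / 4).unpair.2 < n + 1 := lt_of_le_of_lt (Nat.unpair_right_le _) h
    if n % 4 = 0 then name (n / 4)
    else if n % 4 = 1 then neg (ofNat (n / 4))
    else if n % 4 = 2 then inf (ofNat (n / 4).unpair.1) (ofNat (n / 4).unpair.2)
    else ex (n / 4).unpair.1 (ofNat (n / 4).unpair.2)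

theorem ofNat_toNat (C : Concept) : ofNat C.toNat = C := by
  induction C with
  | top => rw [toNat, ofNat]
  | name A =>
    rw [toNat, ofNat]
    simp
  | neg C ih =>
    rw [toNat, ofNat]
    have h : (4 * C.toNat + 1) % 4 = 1 := by omega
    have : (4 * C.toNat + 1) / 4 = C.toNat := by omega
    simp [h, this, ih]
  | inf C D ih1 ih2 =>
    rw [toNat, ofNat]
    have h : (4 * Nat.pair C.toNat D.toNat + 2) % 4 = 2 := by omega
    have : (4 * Nat.pair C.toNat D.toNat + 2) / 4 = Nat.pair C.toNat D.toNat := by omega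
    simp [h, this, ih1, ih2]
  | ex r C ih =>
    rw [toNat, ofNat]
    have h : (4 * Nat.pair r C.toNat + 3) % 4 = 3 := by omega
    have : (4 * Nat.pair r C.toNat + 3) / 4 = Nat.pair r C.toNat := by omega
    simp [h, this, ih]

theorem toNat_ofNat (n : ℕ) : (ofNat n).toNat = n := by
  induction n using Nat.strong_induction_on with
  | _ n ih =>
    cases n with
    | zero => rw [ofNat, toNat]
    | succ n =>
      rw [ofNat]
      have e1 : Nat.pair (n / 4).unpair.1 (n / 4).unpair.2 = n / 4 := Nat.pair_unpair _
      have h : n / 4 < n + 1 := by omega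
      have h1 : (n / 4).unpair.1 < n + 1 := lt_of_le_of_lt (Nat.unpair_left_le _) h
      have h2 : (n / 4).unpair.2 < n + 1 := lt_of_le_of_lt (Nat.unpair_right_le _) h
      split_ifs with a b c
      · rw [toNat]
        omega
      · rw [toNat, ih _ h]
        omega
      · rw [toNat, ih _ h1, ih _ h2, e1]
        omega
      · rw [toNat, ih _ h2, e1]
        omega

def equivNat : Concept ≃ ℕ := ⟨toNat, ofNat, ofNat_toNat, toNat_ofNat⟩

instance : Primcodable Concept := Primcodable.ofEquiv ℕ equivNat

def sig : Concept → Finset Predicate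
  | top => ∅
  | name A => {(A, 1)}
  | neg C => C.sig
  | inf C D => C.sig ∪ D.sig
  | ex r C => insert (r, 2) C.sig

/-- The extension of a concept in the structure with domain `X`. -/
def ext (X : Type) [predLang.Structure X] : Concept → Set X
  | top => Set.univ
  | name A => {d | FirstOrder.Language.Structure.RelMap (L := predLang) (n := 1) A ![d]}
  | neg C => (C.ext X)ᶜ
  | inf C D => C.ext X ∩ D.ext X
  | ex r C =>
      {d | ∃ e ∈ C.ext X, FirstOrder.Language.Structure.RelMap (L := predLang) (n := 2) r ![d, e]}

end Concept

/-- An ALC TBox: a finite set of concept inclusions `C ⊑ D`, given as a list of pairs `(C, D)`. -/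
abbrev TBox := List (Concept × Concept)

namespace TBox

def sig : TBox → Finset Predicate
  | [] => ∅
  | p :: T => p.1.sig ∪ p.2.sig ∪ sig T

def IsModel (T : TBox) (X : Type) [predLang.Structure X] : Prop :=
  ∀ p ∈ T, p.1.ext X ⊆ p.2.ext X

/-- The sentence `ψ` is a logical consequence of the TBox `T`. -/
def Consequence (T : TBox) (ψ : Formula) : Prop :=
  ∀ (X : Type) [predLang.Structure X] (v : ℕ → X), T.IsModel X → ψ.Holds v

/-- `T₁ ∪ T₂` is a conservative extension of `T₁`, where the separating sentences are
`F`-sentences. -/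
def ConservativeExt (F : Set Formula) (T₁ T₂ : TBox) : Prop :=
  ∀ ψ ∈ F, ψ.IsSentence → ψ.sig ⊆ T₁.sig →
    TBox.Consequence (T₁ ++ T₂) ψ → T₁.Consequence ψ

end TBox

end FOFrag

/-!
All five problems are shown to be undecidable by one reduction from the termination problem of the
programs `Turing.ToPartrec.Code`. A program `c` with undecidable termination on the inputs `[n]` is
fixed, and `n` is mapped to a pair of `ALC` TBoxes, `treeTBox c n` and `failTBox c`, of which only
one axiom depends on `n`.

**Evaluation trees.** A run of a program is represented by a pointer structure. A call has pointers
to its input list, to its output list and to its recursive calls, and lists and numbers are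
themselves pointer structures (head, tail, predecessor). Correctness of a call then is a matter of
finitely many *path equations*, such as "the input of the second recursive call is the output of the
first one" for a composition; see `pathEqs`, `calls` and `rules`. By `Interp.Good.sound`, a call
that is the root of a well-founded tree of calls that satisfy their path equations computes the
right output, and in particular the program terminates. This also works if pointers are not
functional. Conversely, a terminating run yields a finite evaluation tree, cut out of the standard
tree on `Obj` (`Obj.good_call`, `Obj.finitelyGenerated_call`).

**The TBoxes.** `ALC` cannot express path equations, so `treeTBox c n` only says that there is a
correctly marked call of `c` on `[n]`. With fresh predicates, `failTBox c` says that such a call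
fails: recursive calls lead from it to a violated path equation (the two paths have ends inside and
outside of a fresh concept name), or on and on forever.

* If `c` diverges on `[n]`, then by soundness each model of the first TBox has a failing call, so it
  can be expanded to a model of the second one (`exists_expansion`). Hence no formula without fresh
  predicates, in whatever fragment, is a new consequence (`consequence_of_diverges`).
* If `c` terminates on `[n]`, a finite evaluation tree is a model of the first TBox. With an
  additional chain through its elements, each element is definable in the two-variable fragment, and
  since that fragment has equality, one sentence fixes the structure (`exists_diagram`). No model of
  this sentence has a failing call, so its negation is a new consequence (`exists_separator`).

The sentences for the first four problems are the standard translations of the TBoxes. The maps from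
`n` to TBoxes and sentences are primitive recursive.
-/

namespace FOFrag

open Turing.ToPartrec (Code)

/-! ### Unary and binary predicates of a structure -/

/-- The extension of the unary predicate with index `k`. -/
abbrev Un {X : Type} [predLang.Structure X] (k : ℕ) (x : X) : Prop :=
  FirstOrder.Language.Structure.RelMap (L := predLang) (n := 1) k ![x]

/-- The extension of the binary predicate with index `r`. -/
abbrev Bi {X : Type} [predLang.Structure X] (r : ℕ) (x y : X) : Prop :=
  FirstOrder.Language.Structure.RelMap (L := predLang) (n := 2) r ![x, y]

/-- The structure with the given unary and binary predicates, all others being empty. -/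
abbrev mkStructure {X : Type} (u : ℕ → X → Prop) (b : ℕ → X → X → Prop) : predLang.Structure X where
  funMap f := Empty.elim f
  RelMap {n} := match n with
    | 1 => fun R xs => u R (xs 0)
    | 2 => fun R xs => b R (xs 0) (xs 1)
    | _ => fun _ _ => False

/-- The structure that interprets the predicates in `S` as `s` does and all others as `t` does. -/
noncomputable abbrev mixStructure {X : Type} (S : Set Predicate) (s t : predLang.Structure X) :
    predLang.Structure X where
  funMap f := Empty.elim f
  RelMap {n} R xs := ((R, n) ∈ S ∧ s.RelMap R xs) ∨ ((R, n) ∉ S ∧ t.RelMap R xs)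

/-- The structures `s` and `t` interpret the predicates in `S` in the same way. -/
def AgreeOn {X : Type} (S : Set Predicate) (s t : predLang.Structure X) : Prop :=
  ∀ R n, (R, n) ∈ S → ∀ xs : Fin n → X, s.RelMap R xs ↔ t.RelMap R xs

theorem AgreeOn.mono {X : Type} {S S' : Set Predicate} {s t : predLang.Structure X}
    (h : AgreeOn S s t) (hS : S' ⊆ S) : AgreeOn S' s t := fun R n h' => h R n (hS h')

theorem mixStructure_agree_left {X : Type} (S : Set Predicate) (s t : predLang.Structure X) :
    AgreeOn S (mixStructure S s t) s := by
  intro R n h xs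
  change ((R, n) ∈ S ∧ _) ∨ ((R, n) ∉ S ∧ _) ↔ _
  simp only [h, true_and, not_true_eq_false, false_and, or_false]

theorem mixStructure_agree_right {X : Type} (S : Set Predicate) (s t : predLang.Structure X) :
    AgreeOn Sᶜ (mixStructure S s t) t := by
  intro R n h xs
  change ((R, n) ∈ S ∧ _) ∨ ((R, n) ∉ S ∧ _) ↔ _
  simp only [show (R, n) ∉ S from h, false_and, not_false_eq_true, true_and, false_or]

theorem Formula.holds_congr {X : Type} {s t : predLang.Structure X} {φ : Formula} {v : ℕ → X}
    (h : AgreeOn φ.sig s t) :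
    @Formula.Holds X s v φ ↔ @Formula.Holds X t v φ := by
  induction φ generalizing v with
  | eq x y => rfl
  | rel R xs => exact h R xs.length (by simp [Formula.sig]) _
  | neg φ ih => exact not_congr (ih h)
  | and φ ψ ih1 ih2 =>
    exact and_congr (ih1 (h.mono (by simp [Formula.sig])))
      (ih2 (h.mono (by simp [Formula.sig])))
  | ex x φ ih => exact exists_congr fun a => ih h

theorem Formula.holds_rel_one {X : Type} [predLang.Structure X] {k i : ℕ} {v : ℕ → X} :
    (Formula.rel k [i]).Holds v ↔ Un k (v i) := by
  rw [Formula.Holds, Un]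
  have : (fun j : Fin [i].length => v ([i].get j)) = (![v i] : Fin 1 → X) := by
    funext j
    fin_cases j
    rfl
  rw [← this]

theorem Formula.holds_rel_two {X : Type} [predLang.Structure X] {r i j : ℕ} {v : ℕ → X} :
    (Formula.rel r [i, j]).Holds v ↔ Bi r (v i) (v j) := by
  rw [Formula.Holds, Bi]
  have : (fun k : Fin [i, j].length => v ([i, j].get k)) = (![v i, v j] : Fin 2 → X) := by
    funext k
    fin_cases k <;> rfl
  rw [← this]

/-! ### Building two-variable formulas -/

namespace Formula

/-- The formula `φ` only has the variables `0` and `1`, its free variables are among `V` and its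
predicates among `S`. -/
def Within (V : Finset ℕ) (S : Set Predicate) (φ : Formula) : Prop :=
  φ.vars ⊆ {0, 1} ∧ φ.freeVars ⊆ V ∧ ∀ p ∈ φ.sig, p ∈ S

variable {V V' : Finset ℕ} {S S' : Set Predicate} {φ ψ : Formula}

theorem Within.neg (h : φ.Within V S) : (Formula.neg φ).Within V S := h

theorem Within.and (h : φ.Within V S) (h' : ψ.Within V S) : (Formula.and φ ψ).Within V S :=
  ⟨Finset.union_subset h.1 h'.1, Finset.union_subset h.2.1 h'.2.1, fun p hp =>
    (Finset.mem_union.1 hp).elim (h.2.2 p) (h'.2.2 p)⟩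

theorem Within.ex {x : ℕ} (h : φ.Within V' S) (hx : x ∈ ({0, 1} : Finset ℕ))
    (hV : V'.erase x ⊆ V) : (Formula.ex x φ).Within V S :=
  ⟨Finset.insert_subset hx h.1, (Finset.erase_subset_erase x h.2.1).trans hV, h.2.2⟩

theorem within_eq {x y : ℕ} (hx : {x, y} ⊆ ({0, 1} : Finset ℕ)) (hV : {x, y} ⊆ V) :
    (Formula.eq x y).Within V S :=
  ⟨hx, hV, by simp [sig]⟩

theorem within_rel {R : ℕ} {xs : List ℕ} (hx : xs.toFinset ⊆ ({0, 1} : Finset ℕ))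
    (hV : xs.toFinset ⊆ V) (hS : (R, xs.length) ∈ S) : (Formula.rel R xs).Within V S :=
  ⟨hx, hV, by simpa [sig] using hS⟩

theorem Within.mono (h : φ.Within V S) (hV : V ⊆ V') (hS : S ⊆ S') : φ.Within V' S' :=
  ⟨h.1, h.2.1.trans hV, fun p hp => hS (h.2.2 p hp)⟩

theorem Within.isSentence (h : φ.Within ∅ S) : φ.IsSentence := Finset.subset_empty.1 h.2.1

/-- `φ(0)` rewritten as a formula whose free variable is `1`. -/
def shift (φ : Formula) : Formula := ex 0 (and (eq 0 1) φ)

theorem Within.shift (h : φ.Within {0} S) : φ.shift.Within {1} S :=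
  ((within_eq (by decide) (by decide)).and
    (h.mono (V' := {0, 1}) (by decide) subset_rfl)).ex (by decide) (by decide)

theorem holds_shift {X : Type} [predLang.Structure X] {Q : X → Prop}
    (h : ∀ w : ℕ → X, φ.Holds w ↔ Q (w 0)) (v : ℕ → X) : φ.shift.Holds v ↔ Q (v 1) := by
  simp only [Formula.shift, Holds, h]
  constructor
  · rintro ⟨a, h1, h2⟩
    simp only [Function.update_self, ne_eq, one_ne_zero, not_false_eq_true,
      Function.update_of_ne] at h1 h2
    rwa [← h1]
  · exact fun h' => ⟨v 1, by simp, by simpa using h'⟩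

/-- A sentence that holds in every structure. -/
def truth : Formula := ex 0 (eq 0 0)

theorem holds_truth {X : Type} [predLang.Structure X] {v : ℕ → X} : truth.Holds v :=
  ⟨v 0, rfl⟩

theorem within_truth : truth.Within V S :=
  (within_eq (V := {0}) (by decide) (by decide)).ex (by decide) (by simp)

/-- The conjunction of a list of formulas. -/
def conj : List Formula → Formula
  | [] => truth
  | φ :: l => and φ (conj l)

theorem holds_conj {X : Type} [predLang.Structure X] {v : ℕ → X} {l : List Formula} :
    (conj l).Holds v ↔ ∀ φ ∈ l, φ.Holds v := by
  induction l with
  | nil => simp [conj, holds_truth]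
  | cons φ l ih => simp [conj, Holds, ih]

theorem within_conj {l : List Formula} (h : ∀ φ ∈ l, φ.Within V S) : (conj l).Within V S := by
  induction l with
  | nil => exact within_truth
  | cons φ l ih =>
    simp only [List.forall_mem_cons] at h
    exact h.1.and (ih h.2)

end Formula

/-! ### Translation of TBoxes into first-order sentences -/

namespace Concept

/-- The standard translation of a concept; its only free variable is `0`. -/
def toFormula : Concept → Formula
  | top => .eq 0 0
  | name A => .rel A [0]
  | neg C => .neg C.toFormula
  | inf C D => .and C.toFormula D.toFormula
  | ex r C => .ex 1 (.and (.rel r [0, 1]) C.toFormula.shift)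

theorem toFormula_within (C : Concept) : C.toFormula.Within {0} C.sig := by
  induction C with
  | top => exact Formula.within_eq (by decide) (by decide)
  | name A => exact Formula.within_rel (by decide) (by decide) (by simp [sig])
  | neg C ih => exact ih.neg
  | inf C D ihC ihD =>
    exact (ihC.mono subset_rfl (by simp [sig])).and (ihD.mono subset_rfl (by simp [sig]))
  | ex r C ih =>
    refine Formula.Within.ex (V' := {0, 1}) ?_ (by decide) (by decide)
    exact (Formula.within_rel (by decide) (by decide) (by simp [sig])).and
      (ih.shift.mono (by decide) (by simp [sig]))

theorem sig_toFormula (C : Concept) : C.toFormula.sig = C.sig := by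
  induction C with
  | top => rfl
  | name A => rfl
  | neg C ih => exact ih
  | inf C D ihC ihD => simp [toFormula, Formula.sig, sig, ihC, ihD]
  | ex r C ih => simp [toFormula, Formula.shift, Formula.sig, sig, ih]

theorem holds_toFormula {X : Type} [predLang.Structure X] (C : Concept) (v : ℕ → X) :
    C.toFormula.Holds v ↔ v 0 ∈ C.ext X := by
  induction C generalizing v with
  | top => simp [toFormula, Formula.Holds, ext]
  | name A => exact Formula.holds_rel_one
  | neg C ih => exact not_congr (ih v)
  | inf C D ihC ihD => exact and_congr (ihC v) (ihD v)
  | ex r C ih =>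
    have hu := Formula.holds_shift (φ := C.toFormula) (Q := (· ∈ C.ext X)) ih
    simp only [toFormula, Formula.Holds.eq_4, Formula.Holds.eq_5, Formula.holds_rel_two, hu, ext,
      Set.mem_ofPred_eq]
    exact exists_congr fun a => by simp [and_comm]

end Concept

namespace TBox

/-- The sentence that expresses the concept inclusion `C ⊑ D`. -/
def inclusion (p : Concept × Concept) : Formula :=
  .neg (.ex 0 (.and p.1.toFormula (.neg p.2.toFormula)))

/-- The standard translation of a TBox. -/
def toFormula : TBox → Formula
  | [] => .truth
  | p :: T => .and (inclusion p) (toFormula T)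

theorem sig_toFormula (T : TBox) : T.toFormula.sig = T.sig := by
  induction T with
  | nil => rfl
  | cons p T ih => simp [toFormula, inclusion, Formula.sig, sig, ih, Concept.sig_toFormula]

theorem toFormula_within (T : TBox) : T.toFormula.Within ∅ T.sig := by
  induction T with
  | nil => exact Formula.within_truth
  | cons p T ih =>
    refine Formula.Within.and (Formula.Within.neg ?_) (ih.mono subset_rfl fun x hx => by
      simp [sig, Finset.mem_coe.1 hx])
    refine Formula.Within.ex (V' := {0}) ?_ (by decide) (by decide)
    have h1 : (p.1.sig : Set Predicate) ⊆ TBox.sig (p :: T) := fun x hx => by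
      simp [sig, Finset.mem_coe.1 hx]
    have h2 : (p.2.sig : Set Predicate) ⊆ TBox.sig (p :: T) := fun x hx => by
      simp [sig, Finset.mem_coe.1 hx]
    exact (p.1.toFormula_within.mono subset_rfl h1).and
      (p.2.toFormula_within.mono subset_rfl h2).neg

theorem holds_toFormula {X : Type} [predLang.Structure X] (T : TBox) (v : ℕ → X) :
    T.toFormula.Holds v ↔ T.IsModel X := by
  induction T with
  | nil => simp [toFormula, Formula.holds_truth, IsModel]
  | cons p T ih =>
    have : (inclusion p).Holds v ↔ p.1.ext X ⊆ p.2.ext X := by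
      simp [inclusion, Formula.Holds, Concept.holds_toFormula, Set.subset_def]
    simp [toFormula, Formula.Holds, IsModel, this, ih]

theorem isModel_congr {X : Type} [Nonempty X] {s t : predLang.Structure X} {T : TBox}
    (h : AgreeOn T.sig s t) : @IsModel T X s ↔ @IsModel T X t := by
  obtain ⟨x⟩ := ‹Nonempty X›
  rw [← @holds_toFormula X s T fun _ => x, ← @holds_toFormula X t T fun _ => x]
  exact Formula.holds_congr (by rwa [sig_toFormula])

theorem arity_of_mem_sig {T : TBox} {p : Predicate} (h : p ∈ T.sig) : p.2 = 1 ∨ p.2 = 2 := by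
  have hC : ∀ C : Concept, p ∈ C.sig → p.2 = 1 ∨ p.2 = 2 := by
    intro C
    induction C with
    | top => simp [Concept.sig]
    | name A => simp +contextual [Concept.sig]
    | neg C ih => exact ih
    | inf C D ihC ihD => exact fun h => (Finset.mem_union.1 h).elim ihC ihD
    | ex r C ih =>
      intro h
      rcases Finset.mem_insert.1 h with rfl | h
      · exact .inr rfl
      · exact ih h
  induction T with
  | nil => simp [sig] at h
  | cons q T ih =>
    simp only [sig, Finset.mem_union] at h
    rcases h with (h | h) | h
    · exact hC _ h
    · exact hC _ h
    · exact ih h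

theorem within_mem_FO2 {T : TBox} {V : Finset ℕ} {φ : Formula} (h : φ.Within V T.sig) : φ ∈ FO2 :=
  ⟨h.1, fun p hp => arity_of_mem_sig (Finset.mem_coe.1 (h.2.2 p hp))⟩

end TBox

/-! ### Describing a finite structure by a two-variable sentence -/

/-- In a structure whose elements form an `nx`-chain that ends in the only element of `last`, this
formula defines the element at distance `i` from the end. The end may be its own `nx`-successor,
which is why it is excluded explicitly for `i > 0`. -/
def chainFormula (last nx : ℕ) : ℕ → Formula
  | 0 => .rel last [0]
  | i + 1 => .and (.neg (.rel last [0]))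
      (.ex 1 (.and (.rel nx [0, 1]) (chainFormula last nx i).shift))

/-- The meaning of `chainFormula`. -/
def InChain {X : Type} [predLang.Structure X] (last nx : ℕ) : ℕ → X → Prop
  | 0, x => Un last x
  | i + 1, x => ¬ Un last x ∧ ∃ y, Bi nx x y ∧ InChain last nx i y

theorem holds_chainFormula {X : Type} [predLang.Structure X] {last nx i : ℕ} {v : ℕ → X} :
    (chainFormula last nx i).Holds v ↔ InChain last nx i (v 0) := by
  induction i generalizing v with
  | zero => exact Formula.holds_rel_one
  | succ i ih =>
    have hs := Formula.holds_shift (Q := InChain last nx i) fun w => ih (v := w)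
    simp only [chainFormula, Formula.Holds.eq_3, Formula.Holds.eq_4, Formula.Holds.eq_5,
      Formula.holds_rel_one, Formula.holds_rel_two, hs, InChain]
    simp

theorem chainFormula_within {last nx i : ℕ} {S : Set Predicate} (h1 : (last, 1) ∈ S)
    (h2 : (nx, 2) ∈ S) : (chainFormula last nx i).Within {0} S := by
  induction i with
  | zero => exact Formula.within_rel (by decide) (by decide) h1
  | succ i ih =>
    refine (Formula.within_rel (by decide) (by decide) h1).neg.and
      (Formula.Within.ex (V' := {0, 1}) ?_ (by decide) (by decide))
    exact (Formula.within_rel (by decide) (by decide) h2).and (ih.shift.mono (by decide) subset_rfl)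

theorem holds_chainFormula_shift {X : Type} [predLang.Structure X] {last nx i : ℕ} {v : ℕ → X} :
    (chainFormula last nx i).shift.Holds v ↔ InChain last nx i (v 1) :=
  Formula.holds_shift (fun _ => holds_chainFormula) v

theorem inChain_iff {A : Type} [predLang.Structure A] {N last nx : ℕ} (e : A ≃ Fin N)
    (hlast : ∀ a, Un last a ↔ (e a : ℕ) = 0)
    (hnx : ∀ a b, Bi nx a b ↔ (e b : ℕ) = e a - 1) {i : ℕ} {a : A} :
    InChain last nx i a ↔ (e a : ℕ) = i := by
  induction i generalizing a with
  | zero => exact hlast a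
  | succ i ih =>
    simp only [InChain, hlast, hnx, ih]
    constructor
    · rintro ⟨h, b, h1, h2⟩
      omega
    · intro h
      exact ⟨by omega, e.symm ⟨i, by have := (e a).2; omega⟩, by simp; omega, by simp⟩

/-- A finite structure whose elements form a chain is described by a two-variable sentence, as far
as the given unary and binary predicates are concerned: each model of the sentence maps injectively
into the structure, and these predicates are preserved. -/
theorem exists_diagram {A : Type} [predLang.Structure A] {N last nx : ℕ} (e : A ≃ Fin N)
    (hlast : ∀ a, Un last a ↔ (e a : ℕ) = 0)
    (hnx : ∀ a b, Bi nx a b ↔ (e b : ℕ) = e a - 1) (us bs : List ℕ) {S : Set Predicate}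
    (h1 : (last, 1) ∈ S) (h2 : (nx, 2) ∈ S) (hus : ∀ k ∈ us, (k, 1) ∈ S)
    (hbs : ∀ r ∈ bs, (r, 2) ∈ S) :
    ∃ χ : Formula, χ.Within ∅ S ∧ (∀ v : ℕ → A, χ.Holds v) ∧
      ∀ (X : Type) [predLang.Structure X] (v : ℕ → X), χ.Holds v → ∃ h : X → A,
        Function.Injective h ∧ (∀ k ∈ us, ∀ x, Un k x → Un k (h x)) ∧
        ∀ r ∈ bs, ∀ x y, Bi r x y → Bi r (h x) (h y) := by
  classical
  let δ := chainFormula last nx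
  have hδ {i : ℕ} : (δ i).Within {0} S := chainFormula_within h1 h2
  have hδ01 {i : ℕ} : (δ i).Within {0, 1} S := hδ.mono (by decide) subset_rfl
  have hσ {i : ℕ} : (δ i).shift.Within {0, 1} S := hδ.shift.mono (by decide) subset_rfl
  -- every element lies on the chain
  let cover : Formula := .neg (.ex 0 (.conj ((List.finRange N).map fun i => .neg (δ i))))
  -- the position on the chain determines the element
  let uniq (i : Fin N) : Formula :=
    .neg (.ex 0 (.ex 1 (.and (.and (δ i) (δ i).shift) (.neg (.eq 0 1)))))
  let unary (k : ℕ) (i : Fin N) : Formula :=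
    if Un k (e.symm i) then .truth else .neg (.ex 0 (.and (δ i) (.rel k [0])))
  let binary (r : ℕ) (i j : Fin N) : Formula :=
    if Bi r (e.symm i) (e.symm j) then .truth
    else .neg (.ex 0 (.ex 1 (.and (.and (δ i) (δ j).shift) (.rel r [0, 1]))))
  let χ : Formula := .and (.and cover (.conj ((List.finRange N).map uniq)))
    (.and (.conj (us.flatMap fun k => (List.finRange N).map (unary k)))
      (.conj (bs.flatMap fun r => (List.finRange N).flatMap fun i =>
        (List.finRange N).map (binary r i))))
  have sem : ∀ (X : Type) [predLang.Structure X] (v : ℕ → X), χ.Holds v ↔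
      ((∀ x : X, ∃ i : Fin N, InChain last nx i x) ∧
        (∀ (i : Fin N) (x y : X), InChain last nx i x → InChain last nx i y → x = y)) ∧
      (∀ k ∈ us, ∀ i : Fin N, ¬ Un k (e.symm i) → ∀ x : X, InChain last nx i x → ¬ Un k x) ∧
      ∀ r ∈ bs, ∀ i j : Fin N, ¬ Bi r (e.symm i) (e.symm j) → ∀ x y : X,
        InChain last nx i x → InChain last nx j y → ¬ Bi r x y := by
    intro X _ v
    refine and_congr (and_congr ?_ ?_) (and_congr ?_ ?_)
    · simp only [cover, δ, Formula.Holds.eq_3, Formula.Holds.eq_5, Formula.holds_conj,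
        List.forall_mem_map, holds_chainFormula]
      simp
    · simp only [uniq, δ, Formula.Holds.eq_1, Formula.Holds.eq_3, Formula.Holds.eq_4,
        Formula.Holds.eq_5, Formula.holds_conj, List.forall_mem_map, holds_chainFormula,
        holds_chainFormula_shift]
      simp
    · simp only [Formula.holds_conj, List.mem_flatMap, List.mem_map, List.mem_finRange, true_and,
        forall_exists_index, and_imp]
      have (k : ℕ) (i : Fin N) : (unary k i).Holds v ↔
          (¬ Un k (e.symm i) → ∀ x : X, InChain last nx i x → ¬ Un k x) := by
        by_cases h : Un k (e.symm i)
        · simp only [unary, if_pos h]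
          exact ⟨fun _ h' => (h' h).elim, fun _ => Formula.holds_truth⟩
        · simp only [unary, if_neg h, δ, Formula.Holds.eq_3, Formula.Holds.eq_4,
            Formula.Holds.eq_5, holds_chainFormula, Formula.holds_rel_one]
          simp [h]
      constructor
      · exact fun h k hk i => (this k i).1 (h _ k hk i rfl)
      · rintro h _ k hk i rfl
        exact (this k i).2 (h k hk i)
    · simp only [Formula.holds_conj, List.mem_flatMap, List.mem_map, List.mem_finRange, true_and,
        forall_exists_index, and_imp]
      have (r : ℕ) (i j : Fin N) : (binary r i j).Holds v ↔
          (¬ Bi r (e.symm i) (e.symm j) → ∀ x y : X,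
            InChain last nx i x → InChain last nx j y → ¬ Bi r x y) := by
        by_cases h : Bi r (e.symm i) (e.symm j)
        · simp only [binary, if_pos h]
          exact ⟨fun _ h' => (h' h).elim, fun _ => Formula.holds_truth⟩
        · simp only [binary, if_neg h, δ, Formula.Holds.eq_3, Formula.Holds.eq_4,
            Formula.Holds.eq_5, holds_chainFormula, holds_chainFormula_shift,
            Formula.holds_rel_two]
          simp [h]
      constructor
      · exact fun h r hr i j => (this r i j).1 (h _ r hr i j rfl)
      · rintro h _ r hr i j rfl
        exact (this r i j).2 (h r hr i j)
  refine ⟨χ, ?_, fun v => ?_, fun X _ v hv => ?_⟩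
  · refine ((Formula.Within.neg ?_).and (Formula.within_conj ?_)).and
      ((Formula.within_conj ?_).and (Formula.within_conj ?_))
    · refine Formula.Within.ex (V' := {0}) (Formula.within_conj ?_) (by decide) (by decide)
      simp only [List.forall_mem_map]
      exact fun i _ => hδ.neg
    · simp only [List.forall_mem_map]
      exact fun i _ => (Formula.Within.ex (V' := {0}) (Formula.Within.ex (V' := {0, 1})
        ((hδ01.and hσ).and (Formula.within_eq (by decide) (by decide)).neg)
        (by decide) (by decide)) (by decide) (by decide)).neg
    · simp only [List.mem_flatMap, List.mem_map]
      rintro _ ⟨k, hk, i, -, rfl⟩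
      simp only [unary]
      split_ifs
      · exact Formula.within_truth
      · exact (Formula.Within.ex (V' := {0}) (hδ.and
          (Formula.within_rel (by decide) (by decide) (hus k hk))) (by decide) (by decide)).neg
    · simp only [List.mem_flatMap, List.mem_map]
      rintro _ ⟨r, hr, i, -, j, -, rfl⟩
      simp only [binary]
      split_ifs
      · exact Formula.within_truth
      · exact (Formula.Within.ex (V' := {0}) (Formula.Within.ex (V' := {0, 1})
          ((hδ01.and hσ).and (Formula.within_rel (by decide) (by decide) (hbs r hr)))
          (by decide) (by decide)) (by decide) (by decide)).neg
  · rw [sem]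
    simp only [inChain_iff e hlast hnx]
    refine ⟨⟨fun x => ⟨e x, rfl⟩, fun i x y hx hy => ?_⟩, fun k _ i hk x hx => ?_,
      fun r _ i j hr x y hx hy => ?_⟩
    · exact e.injective (Fin.ext (hx.trans hy.symm))
    · rwa [e.symm_apply_eq.2 (Fin.ext hx).symm] at hk
    · rwa [e.symm_apply_eq.2 (Fin.ext hx).symm, e.symm_apply_eq.2 (Fin.ext hy).symm] at hr
  · obtain ⟨⟨c1, c2⟩, c3, c4⟩ := (sem X v).1 hv
    choose f hf using c1
    refine ⟨fun x => e.symm (f x), fun x y hxy => ?_, fun k hk x hx => ?_, fun r hr x y hxy => ?_⟩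
    · have hxy : f x = f y := e.symm.injective hxy
      exact c2 (f x) x y (hf x) (hxy ▸ hf y)
    · by_contra h
      exact c3 k hk _ h x (hf x) hx
    · by_contra h
      exact c4 r hr _ _ h x y (hf x) (hf y) hxy

/-! ### Programs and their terminating evaluations -/

/-- The result of running the program `c` on `v`, with the junk value `[]` if it diverges. -/
noncomputable def output (c : Code) (v : List ℕ) : List ℕ := by
  classical exact if h : (c.eval v).Dom then (c.eval v).get h else []

theorem output_eq_of_mem {c : Code} {v w : List ℕ} (h : w ∈ c.eval v) : output c v = w := by
  obtain ⟨hd, rfl⟩ := h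
  simp [output, hd]

theorem output_mem {c : Code} {v : List ℕ} (h : (c.eval v).Dom) : output c v ∈ c.eval v := by
  simpa [output, h] using Part.get_mem h

/-- `Terminates c v` is the inductive counterpart of `(c.eval v).Dom`: there is a finite tree of
recursive calls. It provides the induction principle along that tree. -/
inductive Terminates : Code → List ℕ → Prop
  | zero' (v) : Terminates .zero' v
  | succ (v) : Terminates .succ v
  | tail (v) : Terminates .tail v
  | cons {f fs v} : Terminates f v → Terminates fs v → Terminates (.cons f fs) v
  | comp {f g v} : Terminates g v → Terminates f (output g v) → Terminates (.comp f g) v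
  | case_zero {f g v} : v.headI = 0 → Terminates f v.tail → Terminates (.case f g) v
  | case_succ {f g v n} : v.headI = n + 1 → Terminates g (n :: v.tail) → Terminates (.case f g) v
  | fix_stop {f v} : Terminates f v → (output f v).headI = 0 → Terminates (.fix f) v
  | fix_step {f v} : Terminates f v → (output f v).headI ≠ 0 →
      Terminates (.fix f) (output f v).tail → Terminates (.fix f) v

theorem mem_eval_cons {f fs : Code} {v a w : List ℕ} (ha : a ∈ f.eval v) (hw : w ∈ fs.eval v) :
    (a.headI :: w) ∈ (Code.cons f fs).eval v := by
  rw [Code.cons_eval]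
  exact Part.mem_bind ha (Part.mem_bind hw (Part.mem_some _))

theorem mem_eval_comp {f g : Code} {v u w : List ℕ} (hu : u ∈ g.eval v) (hw : w ∈ f.eval u) :
    w ∈ (Code.comp f g).eval v := by
  rw [Code.comp_eval]
  exact Part.mem_bind hu hw

theorem mem_eval_case_zero {f g : Code} {v w : List ℕ} (h : v.headI = 0)
    (hw : w ∈ f.eval v.tail) : w ∈ (Code.case f g).eval v := by
  rw [Code.case_eval]
  simpa [h] using hw

theorem mem_eval_case_succ {f g : Code} {v w : List ℕ} {n : ℕ} (h : v.headI = n + 1)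
    (hw : w ∈ g.eval (n :: v.tail)) : w ∈ (Code.case f g).eval v := by
  rw [Code.case_eval]
  simpa [h] using hw

theorem mem_eval_fix_stop {f : Code} {v u : List ℕ} (hu : u ∈ f.eval v) (h : u.headI = 0) :
    u.tail ∈ (Code.fix f).eval v := by
  rw [Code.fix_eval]
  refine PFun.fix_stop ?_
  exact (Part.mem_map_iff _).2 ⟨u, hu, by simp [h]⟩

theorem mem_eval_fix_step {f : Code} {v u w : List ℕ} (hu : u ∈ f.eval v) (h : u.headI ≠ 0)
    (hw : w ∈ (Code.fix f).eval u.tail) : w ∈ (Code.fix f).eval v := by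
  rw [Code.fix_eval] at hw ⊢
  exact PFun.mem_fix_iff.2 (.inr ⟨u.tail, (Part.mem_map_iff _).2 ⟨u, hu, by simp [h]⟩, hw⟩)

theorem terminates_of_mem {c : Code} : ∀ {v w : List ℕ}, w ∈ c.eval v → Terminates c v := by
  induction c with
  | zero' => exact fun _ => .zero' _
  | succ => exact fun _ => .succ _
  | tail => exact fun _ => .tail _
  | cons f fs ihf ihs =>
    intro v w h
    rw [Code.cons_eval] at h
    obtain ⟨a, ha, h⟩ := Part.mem_bind_iff.1 h
    obtain ⟨b, hb, -⟩ := Part.mem_bind_iff.1 h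
    exact .cons (ihf ha) (ihs hb)
  | comp f g ihf ihg =>
    intro v w h
    rw [Code.comp_eval] at h
    obtain ⟨a, ha, h⟩ := Part.mem_bind_iff.1 h
    exact .comp (ihg ha) (by rw [output_eq_of_mem ha]; exact ihf h)
  | case f g ihf ihg =>
    intro v w h
    rw [Code.case_eval] at h
    cases hv : v.headI with
    | zero => exact .case_zero hv (ihf (by simpa [hv] using h))
    | succ n => exact .case_succ hv (ihg (by simpa [hv] using h))
  | fix f ih =>
    intro v w h
    rw [Code.fix_eval] at h
    refine PFun.fixInduction (C := fun v => Terminates (.fix f) v) h fun v hv hrec => ?_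
    rcases PFun.mem_fix_iff.1 hv with hs | ⟨v', hs, -⟩
    · obtain ⟨u, hu, he⟩ := (Part.mem_map_iff _).1 hs
      refine Terminates.fix_stop (ih hu) ?_
      rw [output_eq_of_mem hu]
      by_contra hne
      simp [hne] at he
    · obtain ⟨u, hu, he⟩ := (Part.mem_map_iff _).1 hs
      have hne : u.headI ≠ 0 := by
        intro h0
        simp [h0] at he
      rw [if_neg hne, Sum.inr.injEq] at he
      refine Terminates.fix_step (ih hu) (by rwa [output_eq_of_mem hu]) ?_
      rw [output_eq_of_mem hu, he]
      exact hrec _ hs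

theorem Terminates.dom {c : Code} {v : List ℕ} (h : Terminates c v) : (c.eval v).Dom := by
  induction h with
  | zero' v => simp
  | succ v => simp
  | tail v => simp
  | cons _ _ ih1 ih2 =>
    exact Part.dom_iff_mem.2 ⟨_, mem_eval_cons (output_mem ih1) (output_mem ih2)⟩
  | comp _ _ ih1 ih2 =>
    exact Part.dom_iff_mem.2 ⟨_, mem_eval_comp (output_mem ih1) (output_mem ih2)⟩
  | case_zero h _ ih => exact Part.dom_iff_mem.2 ⟨_, mem_eval_case_zero h (output_mem ih)⟩
  | case_succ h _ ih => exact Part.dom_iff_mem.2 ⟨_, mem_eval_case_succ h (output_mem ih)⟩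
  | fix_stop _ h ih => exact Part.dom_iff_mem.2 ⟨_, mem_eval_fix_stop (output_mem ih) h⟩
  | fix_step _ h _ ih1 ih2 =>
    exact Part.dom_iff_mem.2 ⟨_, mem_eval_fix_step (output_mem ih1) h (output_mem ih2)⟩

/-- The subprograms of a program, itself included. -/
def subcodes : Code → List Code
  | .cons f fs => .cons f fs :: (subcodes f ++ subcodes fs)
  | .comp f g => .comp f g :: (subcodes f ++ subcodes g)
  | .case f g => .case f g :: (subcodes f ++ subcodes g)
  | .fix f => .fix f :: subcodes f
  | c => [c]

theorem self_mem_subcodes (c : Code) : c ∈ subcodes c := by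
  cases c <;> simp [subcodes]

/-- An injective numbering of programs. -/
def codeIndex : Code → ℕ
  | .zero' => 0
  | .succ => 1
  | .tail => 2
  | .cons f fs => 4 * Nat.pair (codeIndex f) (codeIndex fs) + 3
  | .comp f g => 4 * Nat.pair (codeIndex f) (codeIndex g) + 4
  | .case f g => 4 * Nat.pair (codeIndex f) (codeIndex g) + 5
  | .fix f => 4 * codeIndex f + 6

theorem codeIndex_injective : Function.Injective codeIndex := by
  intro c
  induction c with
  | zero' | succ | tail => intro d h; cases d <;> simp only [codeIndex] at h <;> first | rfl | omega
  | cons f g ihf ihg | comp f g ihf ihg | case f g ihf ihg =>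
    intro d h
    cases d <;> simp only [codeIndex] at h <;> try omega
    rename_i f' g'
    have h' : Nat.pair (codeIndex f) (codeIndex g) = Nat.pair (codeIndex f') (codeIndex g') := by
      omega
    rw [Nat.pair_eq_pair] at h'
    rw [ihf h'.1, ihg h'.2]
  | fix f ih =>
    intro d h
    cases d <;> simp only [codeIndex] at h <;> try omega
    rename_i f'
    rw [ih (a₂ := f') (by omega)]

/-! ### Evaluation trees as pointer structures -/

/-- The pointers of an evaluation tree. A call has an input list, an output list and up to two
recursive calls `fst`, `snd`; a list cell has a head and a tail; a number has a predecessor. -/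
inductive Ptr
  | inp | out | hd | tl | pred | fst | snd

/-- The marks of an evaluation tree: the numbers zero and successor, the empty list, the outermost
call, and for every program the calls of that program. -/
inductive Mark
  | zero | succ | nil | root
  | code (c : Code)

/-- An interpretation of pointers (as arbitrary binary relations) and marks on a set `X`. -/
structure Interp (X : Type) where
  rel : Ptr → X → X → Prop
  mark : Mark → X → Prop

/-- The end of the path `path` from the current element carries the mark `mark`. -/
structure Guard where
  path : List Ptr
  mark : Mark

/-- The two paths `lhs` and `rhs` lead to the same element, provided that the guard holds. -/
structure PathEq where
  guard : Guard
  lhs : List Ptr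
  rhs : List Ptr

/-- Along the pointer `ptr` the program `code` is called, provided that the guard holds. -/
structure Call where
  guard : Guard
  ptr : Ptr
  code : Code

/-- Elements marked `src` that satisfy the guard have all ends of the path `path` marked `tgt`. -/
structure Rule where
  src : Mark
  guard : Guard
  path : List Ptr
  tgt : Mark

namespace Interp

variable {X Y : Type}

/-- `I.Path π x y`: the element `y` is reached from `x` along the pointers `π`. -/
def Path (I : Interp X) : List Ptr → X → X → Prop
  | [], x, y => x = y
  | p :: π, x, y => ∃ z, I.rel p x z ∧ I.Path π z y

/-- The guard is read existentially: some end of the path carries the mark. -/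
def GuardHolds (I : Interp X) (g : Guard) (x : X) : Prop :=
  ∃ y, I.Path g.path x y ∧ I.mark g.mark y

def RuleHolds (I : Interp X) (r : Rule) : Prop :=
  ∀ x, I.mark r.src x → I.GuardHolds r.guard x → ∀ y, I.Path r.path x y → I.mark r.tgt y

/-- Every pointer is defined everywhere, possibly with several values. -/
def Total (I : Interp X) : Prop := ∀ p x, ∃ y, I.rel p x y

/-- A map that preserves pointers preserves paths. -/
theorem Path.map {I : Interp X} {J : Interp Y} {h : X → Y}
    (hh : ∀ p x y, I.rel p x y → J.rel p (h x) (h y)) :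
    ∀ {π x y}, I.Path π x y → J.Path π (h x) (h y)
  | [], _, _, e => congrArg h e
  | _ :: _, _, _, ⟨z, hz, hp⟩ => ⟨h z, hh _ _ _ hz, Path.map hh hp⟩

end Interp

/-- The guard that holds at every call of `c`. -/
def trivGuard (c : Code) : Guard := ⟨[], .code c⟩

/-- The path equations that a call of the given program has to satisfy. -/
def pathEqs : Code → List PathEq
  | .zero' => [⟨trivGuard .zero', [.out, .tl], [.inp]⟩]
  | .succ => [⟨trivGuard .succ, [.out, .hd, .pred], [.inp, .hd]⟩]
  | .tail => [⟨trivGuard .tail, [.out], [.inp, .tl]⟩]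
  | .cons f fs =>
    [⟨trivGuard (.cons f fs), [.fst, .inp], [.inp]⟩,
     ⟨trivGuard (.cons f fs), [.snd, .inp], [.inp]⟩,
     ⟨trivGuard (.cons f fs), [.out, .hd], [.fst, .out, .hd]⟩,
     ⟨trivGuard (.cons f fs), [.out, .tl], [.snd, .out]⟩]
  | .comp f g =>
    [⟨trivGuard (.comp f g), [.fst, .inp], [.inp]⟩,
     ⟨trivGuard (.comp f g), [.snd, .inp], [.fst, .out]⟩,
     ⟨trivGuard (.comp f g), [.out], [.snd, .out]⟩]
  | .case f g =>
    [⟨⟨[.inp, .hd], .zero⟩, [.fst, .inp], [.inp, .tl]⟩,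
     ⟨⟨[.inp, .hd], .succ⟩, [.fst, .inp, .hd], [.inp, .hd, .pred]⟩,
     ⟨⟨[.inp, .hd], .succ⟩, [.fst, .inp, .tl], [.inp, .tl]⟩,
     ⟨trivGuard (.case f g), [.out], [.fst, .out]⟩]
  | .fix f =>
    [⟨trivGuard (.fix f), [.fst, .inp], [.inp]⟩,
     ⟨⟨[.fst, .out, .hd], .zero⟩, [.out], [.fst, .out, .tl]⟩,
     ⟨⟨[.fst, .out, .hd], .succ⟩, [.snd, .inp], [.fst, .out, .tl]⟩,
     ⟨⟨[.fst, .out, .hd], .succ⟩, [.out], [.snd, .out]⟩]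

/-- The recursive calls made by a call of the given program. -/
def calls : Code → List Call
  | .cons f fs => [⟨trivGuard (.cons f fs), .fst, f⟩, ⟨trivGuard (.cons f fs), .snd, fs⟩]
  | .comp f g => [⟨trivGuard (.comp f g), .fst, g⟩, ⟨trivGuard (.comp f g), .snd, f⟩]
  | .case f g => [⟨⟨[.inp, .hd], .zero⟩, .fst, f⟩, ⟨⟨[.inp, .hd], .succ⟩, .fst, g⟩]
  | .fix f => [⟨trivGuard (.fix f), .fst, f⟩, ⟨⟨[.fst, .out, .hd], .succ⟩, .snd, .fix f⟩]
  | _ => []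

/-- The marks that the output of a call of the given program has to carry. -/
def outputRules : Code → List Rule
  | .zero' => [⟨.code .zero', trivGuard .zero', [.out, .hd], .zero⟩]
  | .succ => [⟨.code .succ, trivGuard .succ, [.out, .hd], .succ⟩,
      ⟨.code .succ, trivGuard .succ, [.out, .tl], .nil⟩]
  | _ => []

/-- The marking rules for the calls of a program: those for its output, and that its recursive calls
are marked. -/
def codeRules (c : Code) : List Rule :=
  outputRules c ++ (calls c).map fun k => ⟨.code c, k.guard, [k.ptr], .code k.code⟩

/-- All marking rules for evaluation trees of `c`. The empty list is its own tail and has head `0`,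
in accordance with `List.tail` and `List.headI`. -/
def rules (c : Code) : List Rule :=
  ⟨.nil, ⟨[], .nil⟩, [.hd], .zero⟩ :: ⟨.nil, ⟨[], .nil⟩, [.tl], .nil⟩ ::
    ⟨.root, ⟨[], .root⟩, [], .code c⟩ :: (subcodes c).flatMap codeRules

theorem calls_subcodes {c : Code} : ∀ {d : Code}, d ∈ subcodes c → ∀ k ∈ calls d,
    k.code ∈ subcodes c := by
  induction c with
  | zero' | succ | tail =>
    intro d hd k hk
    simp only [subcodes, List.mem_singleton] at hd
    subst hd
    simp [calls] at hk
  | cons f g ihf ihg | comp f g ihf ihg | case f g ihf ihg =>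
    intro d hd k hk
    simp only [subcodes, List.mem_cons, List.mem_append] at hd ⊢
    rcases hd with rfl | hd | hd
    · simp only [calls, List.mem_cons, List.not_mem_nil, or_false] at hk
      rcases hk with rfl | rfl <;> simp [self_mem_subcodes]
    · exact .inr (.inl (ihf hd k hk))
    · exact .inr (.inr (ihg hd k hk))
  | fix f ih =>
    intro d hd k hk
    simp only [subcodes, List.mem_cons] at hd ⊢
    rcases hd with rfl | hd
    · simp only [calls, List.mem_cons, List.not_mem_nil, or_false] at hk
      rcases hk with rfl | rfl <;> simp [self_mem_subcodes]
    · exact .inr (ih hd k hk)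

namespace Interp

variable {X : Type} {I : Interp X}

/-- `I.Good c x`: seen as a call of `c`, the element `x` is the root of a well-founded tree of
recursive calls in which all path equations hold. -/
inductive Good (I : Interp X) : Code → X → Prop
  | intro {c x}
      (eqs : ∀ e ∈ pathEqs c, I.GuardHolds e.guard x →
        ∀ y z, I.Path e.lhs x y → I.Path e.rhs x z → y = z)
      (sub : ∀ k ∈ calls c, I.GuardHolds k.guard x → ∀ y, I.rel k.ptr x y → I.Good k.code y) :
      I.Good c x

/-- The element represents the given number. All pointers are followed universally, since they need
not be functional. -/
def RepNum (I : Interp X) : ℕ → X → Prop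
  | 0, x => I.mark .zero x
  | n + 1, x => I.mark .succ x ∧ ∀ y, I.rel .pred x y → I.RepNum n y

/-- The element represents the given list of numbers. -/
def RepList (I : Interp X) : List ℕ → X → Prop
  | [], x => I.mark .nil x
  | a :: v, x => (∀ y, I.rel .hd x y → I.RepNum a y) ∧ ∀ y, I.rel .tl x y → I.RepList v y

theorem RepList.head {c : Code} (hr : ∀ r ∈ rules c, I.RuleHolds r) {v : List ℕ} {x y : X}
    (h : I.RepList v x) (hy : I.rel .hd x y) : I.RepNum v.headI y := by
  cases v with
  | nil =>
    exact hr ⟨.nil, ⟨[], .nil⟩, [.hd], .zero⟩ (by simp [rules]) x h ⟨x, rfl, h⟩ y ⟨y, hy, rfl⟩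
  | cons a v => exact h.1 y hy

theorem RepList.tail {c : Code} (hr : ∀ r ∈ rules c, I.RuleHolds r) {v : List ℕ} {x y : X}
    (h : I.RepList v x) (hy : I.rel .tl x y) : I.RepList v.tail y := by
  cases v with
  | nil =>
    exact hr ⟨.nil, ⟨[], .nil⟩, [.tl], .nil⟩ (by simp [rules]) x h ⟨x, rfl, h⟩ y ⟨y, hy, rfl⟩
  | cons a v => exact h.2 y hy

theorem ruleHolds_of_mem {c d : Code} (hr : ∀ r ∈ rules c, I.RuleHolds r) (hd : d ∈ subcodes c)
    {r : Rule} (h : r ∈ codeRules d) : I.RuleHolds r :=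
  hr r (by
    simp only [rules, List.mem_cons, List.mem_flatMap]
    exact .inr (.inr (.inr ⟨d, hd, h⟩)))

/-- A recursive call made by a marked call is marked. -/
theorem mark_of_call {c d : Code} (hr : ∀ r ∈ rules c, I.RuleHolds r) (hd : d ∈ subcodes c)
    {k : Call} (hk : k ∈ calls d) {x y : X} (hx : I.mark (.code d) x)
    (hg : I.GuardHolds k.guard x) (hy : I.rel k.ptr x y) : I.mark (.code k.code) y :=
  ruleHolds_of_mem hr hd (r := ⟨.code d, k.guard, [k.ptr], .code k.code⟩)
    (List.mem_append_right _ (List.mem_map.2 ⟨k, hk, rfl⟩)) x hx hg y ⟨y, hy, rfl⟩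

theorem guardHolds_triv {c : Code} {x : X} (hx : I.mark (.code c) x) :
    I.GuardHolds (trivGuard c) x := ⟨x, rfl, hx⟩

/-- A good call of `d` on (an element representing) `v` computes `d.eval v`; in particular this is
defined. -/
theorem Good.sound {c : Code} (ht : I.Total) (hr : ∀ r ∈ rules c, I.RuleHolds r)
    {d : Code} {x : X} (h : I.Good d x) (hd : d ∈ subcodes c) (hx : I.mark (.code d) x)
    {v : List ℕ} (hv : ∀ y, I.rel .inp x y → I.RepList v y) :
    ∃ w ∈ d.eval v, ∀ z, I.rel .out x z → I.RepList w z := by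
  induction h generalizing v with
  | @intro d x eqs sub ih =>
    have sub' : ∀ k ∈ calls d, I.GuardHolds k.guard x → ∀ y, I.rel k.ptr x y → ∀ {v},
        (∀ y', I.rel .inp y y' → I.RepList v y') →
        ∃ w ∈ k.code.eval v, ∀ z, I.rel .out y z → I.RepList w z :=
      fun k hk hg y hy => ih k hk hg y hy (calls_subcodes hd k hk) (mark_of_call hr hd hk hx hg hy)
    have post : ∀ r ∈ outputRules d, I.RuleHolds r := fun r h =>
      ruleHolds_of_mem hr hd (List.mem_append_left _ h)
    have htriv := guardHolds_triv hx
    clear ih sub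
    obtain ⟨i, hi⟩ := ht .inp x
    obtain ⟨ih, hih⟩ := ht .hd i
    obtain ⟨it, hit⟩ := ht .tl i
    cases d with
    | zero' =>
      simp only [pathEqs, outputRules, List.forall_mem_singleton, Path, RuleHolds] at eqs post
      refine ⟨0 :: v, by simp, fun z hz => ⟨fun y hy => ?_, fun y hy => ?_⟩⟩
      · exact post x hx htriv y ⟨z, hz, y, hy, rfl⟩
      · rw [eqs htriv y i ⟨z, hz, y, hy, rfl⟩ ⟨i, hi, rfl⟩]
        exact hv i hi
    | succ =>
      simp only [pathEqs, outputRules, List.forall_mem_cons, List.not_mem_nil, false_imp_iff,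
        implies_true, and_true, Path, RuleHolds] at eqs post
      refine ⟨[v.headI.succ], by simp, fun z hz => ⟨fun y hy => ⟨?_, fun y' hy' => ?_⟩,
        fun y hy => ?_⟩⟩
      · exact post.1 x hx htriv y ⟨z, hz, y, hy, rfl⟩
      · rw [eqs htriv y' ih ⟨z, hz, y, hy, y', hy', rfl⟩ ⟨i, hi, ih, hih, rfl⟩]
        exact (hv i hi).head hr hih
      · exact post.2 x hx htriv y ⟨z, hz, y, hy, rfl⟩
    | tail =>
      simp only [pathEqs, List.forall_mem_singleton, Path] at eqs
      refine ⟨v.tail, by simp, fun z hz => ?_⟩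
      rw [eqs htriv z it ⟨z, hz, rfl⟩ ⟨i, hi, it, hit, rfl⟩]
      exact (hv i hi).tail hr hit
    | cons f fs =>
      simp only [pathEqs, calls, List.forall_mem_cons, List.not_mem_nil, false_imp_iff,
        implies_true, and_true, Path] at eqs sub'
      obtain ⟨e1, e2, e3, e4⟩ := eqs
      obtain ⟨a, ha⟩ := ht .fst x
      obtain ⟨b, hb⟩ := ht .snd x
      obtain ⟨w, hw, hw'⟩ := sub'.1 htriv a ha (v := v) fun y hy => by
        rw [e1 htriv y i ⟨a, ha, y, hy, rfl⟩ ⟨i, hi, rfl⟩]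
        exact hv i hi
      obtain ⟨u, hu, hu'⟩ := sub'.2 htriv b hb (v := v) fun y hy => by
        rw [e2 htriv y i ⟨b, hb, y, hy, rfl⟩ ⟨i, hi, rfl⟩]
        exact hv i hi
      obtain ⟨ao, hao⟩ := ht .out a
      obtain ⟨aoh, haoh⟩ := ht .hd ao
      obtain ⟨bo, hbo⟩ := ht .out b
      refine ⟨_, mem_eval_cons hw hu, fun z hz => ⟨fun y hy => ?_, fun y hy => ?_⟩⟩
      · rw [e3 htriv y aoh ⟨z, hz, y, hy, rfl⟩ ⟨a, ha, ao, hao, aoh, haoh, rfl⟩]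
        exact (hw' ao hao).head hr haoh
      · rw [e4 htriv y bo ⟨z, hz, y, hy, rfl⟩ ⟨b, hb, bo, hbo, rfl⟩]
        exact hu' bo hbo
    | comp f g =>
      simp only [pathEqs, calls, List.forall_mem_cons, List.not_mem_nil, false_imp_iff,
        implies_true, and_true, Path] at eqs sub'
      obtain ⟨e1, e2, e3⟩ := eqs
      obtain ⟨a, ha⟩ := ht .fst x
      obtain ⟨b, hb⟩ := ht .snd x
      obtain ⟨ao, hao⟩ := ht .out a
      obtain ⟨bo, hbo⟩ := ht .out b
      obtain ⟨w, hw, hw'⟩ := sub'.1 htriv a ha (v := v) fun y hy => by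
        rw [e1 htriv y i ⟨a, ha, y, hy, rfl⟩ ⟨i, hi, rfl⟩]
        exact hv i hi
      obtain ⟨u, hu, hu'⟩ := sub'.2 htriv b hb (v := w) fun y hy => by
        rw [e2 htriv y ao ⟨b, hb, y, hy, rfl⟩ ⟨a, ha, ao, hao, rfl⟩]
        exact hw' ao hao
      refine ⟨_, mem_eval_comp hw hu, fun z hz => ?_⟩
      rw [e3 htriv z bo ⟨z, hz, rfl⟩ ⟨b, hb, bo, hbo, rfl⟩]
      exact hu' bo hbo
    | case f g =>
      simp only [pathEqs, calls, List.forall_mem_cons, List.not_mem_nil, false_imp_iff,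
        implies_true, and_true, Path, GuardHolds] at eqs sub'
      obtain ⟨e1, e2, e3, e4⟩ := eqs
      obtain ⟨a, ha⟩ := ht .fst x
      obtain ⟨ao, hao⟩ := ht .out a
      have hn := (hv i hi).head hr hih
      cases hv0 : v.headI with
      | zero =>
        rw [hv0] at hn
        have hg : ∃ y, (∃ z, I.rel .inp x z ∧ ∃ z', I.rel .hd z z' ∧ z' = y) ∧ I.mark .zero y :=
          ⟨ih, ⟨i, hi, ih, hih, rfl⟩, hn⟩
        obtain ⟨w, hw, hw'⟩ := sub'.1 hg a ha (v := v.tail) fun y hy => by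
          rw [e1 hg y it ⟨a, ha, y, hy, rfl⟩ ⟨i, hi, it, hit, rfl⟩]
          exact (hv i hi).tail hr hit
        refine ⟨_, mem_eval_case_zero hv0 hw, fun z hz => ?_⟩
        rw [e4 htriv z ao ⟨z, hz, rfl⟩ ⟨a, ha, ao, hao, rfl⟩]
        exact hw' ao hao
      | succ n =>
        rw [hv0] at hn
        obtain ⟨ihp, hihp⟩ := ht .pred ih
        have hg : ∃ y, (∃ z, I.rel .inp x z ∧ ∃ z', I.rel .hd z z' ∧ z' = y) ∧ I.mark .succ y :=
          ⟨ih, ⟨i, hi, ih, hih, rfl⟩, hn.1⟩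
        obtain ⟨w, hw, hw'⟩ := sub'.2 hg a ha (v := n :: v.tail) fun y hy =>
          ⟨fun y' hy' => by
            rw [e2 hg y' ihp ⟨a, ha, y, hy, y', hy', rfl⟩ ⟨i, hi, ih, hih, ihp, hihp, rfl⟩]
            exact hn.2 ihp hihp,
          fun y' hy' => by
            rw [e3 hg y' it ⟨a, ha, y, hy, y', hy', rfl⟩ ⟨i, hi, it, hit, rfl⟩]
            exact (hv i hi).tail hr hit⟩
        refine ⟨_, mem_eval_case_succ hv0 hw, fun z hz => ?_⟩
        rw [e4 htriv z ao ⟨z, hz, rfl⟩ ⟨a, ha, ao, hao, rfl⟩]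
        exact hw' ao hao
    | fix f =>
      simp only [pathEqs, calls, List.forall_mem_cons, List.not_mem_nil, false_imp_iff,
        implies_true, and_true, Path, GuardHolds] at eqs sub'
      obtain ⟨e1, e2, e3, e4⟩ := eqs
      obtain ⟨a, ha⟩ := ht .fst x
      obtain ⟨ao, hao⟩ := ht .out a
      obtain ⟨aoh, haoh⟩ := ht .hd ao
      obtain ⟨aot, haot⟩ := ht .tl ao
      obtain ⟨u, hu, hu'⟩ := sub'.1 htriv a ha (v := v) fun y hy => by
        rw [e1 htriv y i ⟨a, ha, y, hy, rfl⟩ ⟨i, hi, rfl⟩]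
        exact hv i hi
      have hn := (hu' ao hao).head hr haoh
      cases hu0 : u.headI with
      | zero =>
        rw [hu0] at hn
        refine ⟨_, mem_eval_fix_stop hu hu0, fun z hz => ?_⟩
        rw [e2 ⟨aoh, ⟨a, ha, ao, hao, aoh, haoh, rfl⟩, hn⟩ z aot ⟨z, hz, rfl⟩
          ⟨a, ha, ao, hao, aot, haot, rfl⟩]
        exact (hu' ao hao).tail hr haot
      | succ n =>
        rw [hu0] at hn
        have hg : ∃ y, (∃ z, I.rel .fst x z ∧ ∃ z', I.rel .out z z' ∧ ∃ z'', I.rel .hd z' z'' ∧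
            z'' = y) ∧ I.mark .succ y := ⟨aoh, ⟨a, ha, ao, hao, aoh, haoh, rfl⟩, hn.1⟩
        obtain ⟨b, hb⟩ := ht .snd x
        obtain ⟨bo, hbo⟩ := ht .out b
        obtain ⟨w, hw, hw'⟩ := sub'.2 hg b hb (v := u.tail) fun y hy => by
          rw [e3 hg y aot ⟨b, hb, y, hy, rfl⟩ ⟨a, ha, ao, hao, aot, haot, rfl⟩]
          exact (hu' ao hao).tail hr haot
        refine ⟨_, mem_eval_fix_step hu (by omega) hw, fun z hz => ?_⟩
        rw [e4 hg z bo ⟨z, hz, rfl⟩ ⟨b, hb, bo, hbo, rfl⟩]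
        exact hw' bo hbo

end Interp

/-! ### The standard evaluation tree -/

/-- The elements of the standard evaluation tree: numbers, lists, and calls of programs. -/
inductive Obj
  | num (n : ℕ)
  | lst (v : List ℕ)
  | call (c : Code) (v : List ℕ)

namespace Obj

/-- The pointers of the standard evaluation tree are functions. Where a pointer has no meaning, it
leads back to the element itself. -/
noncomputable def step : Ptr → Obj → Obj
  | .hd, lst v => num v.headI
  | .tl, lst v => lst v.tail
  | .pred, num n => num (n - 1)
  | .inp, call _ v => lst v
  | .out, call c v => lst (output c v)
  | .fst, call (.cons f _) v => call f v
  | .fst, call (.comp _ g) v => call g v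
  | .fst, call (.case f g) v =>
    if v.headI = 0 then call f v.tail else call g ((v.headI - 1) :: v.tail)
  | .fst, call (.fix f) v => call f v
  | .snd, call (.cons _ fs) v => call fs v
  | .snd, call (.comp f g) v => call f (output g v)
  | .snd, call (.fix f) v =>
    if (output f v).headI = 0 then call (.fix f) v else call (.fix f) (output f v).tail
  | _, x => x

/-- The interpretation of the marks; only terminating calls are marked. The outermost call is that
of `c₀` on the list `[n]`. -/
def HasMark (c₀ : Code) (n : ℕ) : Mark → Obj → Prop
  | .zero, x => x = num 0
  | .succ, x => ∃ k, x = num (k + 1)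
  | .nil, x => x = lst []
  | .root, x => x = call c₀ [n]
  | .code c, x => ∃ v, x = call c v ∧ Terminates c v

/-- The standard evaluation tree of `c₀` on the input `[n]`. -/
noncomputable def interp (c₀ : Code) (n : ℕ) : Interp Obj where
  rel p x y := step p x = y
  mark := HasMark c₀ n

theorem interp_rel {c₀ : Code} {n : ℕ} {p : Ptr} {x y : Obj} :
    (interp c₀ n).rel p x y ↔ step p x = y := Iff.rfl

theorem interp_mark {c₀ : Code} {n : ℕ} {m : Mark} {x : Obj} :
    (interp c₀ n).mark m x ↔ HasMark c₀ n m x := Iff.rfl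

theorem path_iff {c₀ : Code} {n : ℕ} {π : List Ptr} {x y : Obj} :
    (interp c₀ n).Path π x y ↔ π.foldl (fun x p => step p x) x = y := by
  induction π generalizing x with
  | nil => rfl
  | cons p π ih =>
    rw [List.foldl_cons, ← ih]
    exact ⟨fun ⟨z, hz, h⟩ => by rwa [show step p x = z from hz], fun h => ⟨_, rfl, h⟩⟩

theorem guardHolds_iff {c₀ : Code} {n : ℕ} {g : Guard} {x : Obj} :
    (interp c₀ n).GuardHolds g x ↔
      HasMark c₀ n g.mark (g.path.foldl (fun x p => step p x) x) := by
  simp [Interp.GuardHolds, path_iff, interp_mark]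

/-- A set of elements that is closed under all pointers. -/
def Closed (S : Set Obj) : Prop := ∀ p, ∀ x ∈ S, step p x ∈ S

/-- The element lies in a finite closed set. -/
def FinitelyGenerated (x : Obj) : Prop := ∃ S : Set Obj, S.Finite ∧ Closed S ∧ x ∈ S

theorem finitelyGenerated_of_step {x : Obj}
    (h : ∀ p, step p x = x ∨ FinitelyGenerated (step p x)) : FinitelyGenerated x := by
  have h' : ∀ p, ∃ S : Set Obj, S.Finite ∧ Closed S ∧ (step p x = x ∨ step p x ∈ S) := by
    intro p
    rcases h p with h | ⟨S, h1, h2, h3⟩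
    · exact ⟨∅, Set.finite_empty, fun _ _ h => h.elim, .inl h⟩
    · exact ⟨S, h1, h2, .inr h3⟩
  choose S hf hc hm using h'
  have hfin : Finite Ptr := by
    refine Finite.of_injective
      (fun p : Ptr => (⟨p.ctorIdx, by cases p <;> simp [Ptr.ctorIdx]⟩ : Fin 7)) ?_
    intro p q h
    cases p <;> cases q <;> simp [Ptr.ctorIdx] at h ⊢
  refine ⟨insert x (⋃ p, S p), (Set.finite_iUnion hf).insert x, ?_, Set.mem_insert _ _⟩
  rintro p y (rfl | hy)
  · rcases hm p with h | h
    · exact .inl h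
    · exact .inr (Set.mem_iUnion.2 ⟨p, h⟩)
  · obtain ⟨q, hq⟩ := Set.mem_iUnion.1 hy
    exact .inr (Set.mem_iUnion.2 ⟨q, hc q p y hq⟩)

theorem finitelyGenerated_num (n : ℕ) : FinitelyGenerated (num n) := by
  induction n with
  | zero => exact finitelyGenerated_of_step fun p => by cases p <;> simp [step]
  | succ n ih => exact finitelyGenerated_of_step fun p => by cases p <;> simp [step, ih]

theorem finitelyGenerated_lst (v : List ℕ) : FinitelyGenerated (lst v) := by
  induction v with
  | nil =>
    exact finitelyGenerated_of_step fun p => by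
      cases p <;> simp [step, finitelyGenerated_num]
  | cons a v ih =>
    exact finitelyGenerated_of_step fun p => by
      cases p <;> simp [step, finitelyGenerated_num, ih]

/-- A terminating call only involves finitely many calls, lists and numbers. -/
theorem finitelyGenerated_call {c : Code} {v : List ℕ} (h : Terminates c v) :
    FinitelyGenerated (call c v) := by
  induction h <;>
    exact finitelyGenerated_of_step fun p => by
      cases p <;> simp_all [step, finitelyGenerated_lst]

theorem output_cons {f fs : Code} {v : List ℕ} (h1 : Terminates f v) (h2 : Terminates fs v) :
    output (.cons f fs) v = (output f v).headI :: output fs v :=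
  output_eq_of_mem (mem_eval_cons (output_mem h1.dom) (output_mem h2.dom))

theorem output_comp {f g : Code} {v : List ℕ} (h1 : Terminates g v)
    (h2 : Terminates f (output g v)) : output (.comp f g) v = output f (output g v) :=
  output_eq_of_mem (mem_eval_comp (output_mem h1.dom) (output_mem h2.dom))

theorem output_case_zero {f g : Code} {v : List ℕ} (h : v.headI = 0)
    (h1 : Terminates f v.tail) : output (.case f g) v = output f v.tail :=
  output_eq_of_mem (mem_eval_case_zero h (output_mem h1.dom))

theorem output_case_succ {f g : Code} {v : List ℕ} {n : ℕ} (h : v.headI = n + 1)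
    (h1 : Terminates g (n :: v.tail)) : output (.case f g) v = output g (n :: v.tail) :=
  output_eq_of_mem (mem_eval_case_succ h (output_mem h1.dom))

theorem output_fix_stop {f : Code} {v : List ℕ} (h1 : Terminates f v)
    (h : (output f v).headI = 0) : output (.fix f) v = (output f v).tail :=
  output_eq_of_mem (mem_eval_fix_stop (output_mem h1.dom) h)

theorem output_fix_step {f : Code} {v : List ℕ} (h1 : Terminates f v)
    (h : (output f v).headI ≠ 0) (h2 : Terminates (.fix f) (output f v).tail) :
    output (.fix f) v = output (.fix f) (output f v).tail :=
  output_eq_of_mem (mem_eval_fix_step (output_mem h1.dom) h (output_mem h2.dom))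

theorem output_zero' (v : List ℕ) : output .zero' v = 0 :: v := output_eq_of_mem (by simp)

theorem output_succ (v : List ℕ) : output .succ v = [v.headI + 1] := output_eq_of_mem (by simp)

theorem output_tail (v : List ℕ) : output .tail v = v.tail := output_eq_of_mem (by simp)

/-- In the standard evaluation tree every terminating call is good. -/
theorem good_call (c₀ : Code) (n : ℕ) {c : Code} {v : List ℕ} (h : Terminates c v) :
    (interp c₀ n).Good c (call c v) := by
  induction h <;>
    refine .intro ?_ ?_ <;>
    simp only [pathEqs, calls, List.forall_mem_cons, List.not_mem_nil, false_imp_iff,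
      implies_true, and_true, guardHolds_iff, path_iff, interp_rel]
  all_goals
    simp_all [step, HasMark, output_zero', output_succ, output_tail, output_cons,
      output_comp, output_case_zero, output_fix_stop]
  · rename_i h hg ih
    rw [output_case_succ h hg]
    simp
  · rename_i h1 h2 h3 ih1 ih3
    exact fun _ => output_fix_step h1 h2 h3

/-- The standard evaluation tree obeys the marking rules. -/
theorem ruleHolds (c₀ : Code) {n : ℕ} (h : Terminates c₀ [n]) :
    ∀ r ∈ rules c₀, (interp c₀ n).RuleHolds r := by
  intro r hr x
  rw [guardHolds_iff]
  simp only [path_iff, interp_mark]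
  simp only [rules, List.mem_cons, List.mem_flatMap] at hr
  rcases hr with rfl | rfl | rfl | ⟨d, -, hr⟩
  · rintro rfl - y rfl
    rfl
  · rintro rfl - y rfl
    rfl
  · rintro rfl - y rfl
    exact ⟨_, rfl, h⟩
  · have hsrc : r.src = .code d := by
      simp only [codeRules, List.mem_append, List.mem_map] at hr
      rcases hr with hr | ⟨k, -, rfl⟩
      · cases d <;> simp [outputRules] at hr
        · rw [hr]
        · rcases hr with rfl | rfl <;> rfl
      · rfl
    rw [hsrc]
    rintro ⟨v, rfl, hv⟩
    cases hv <;> simp [codeRules, outputRules, calls] at hr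
    all_goals first | subst hr | rcases hr with rfl | rfl
    all_goals simp_all [step, HasMark, output_zero', output_succ]

end Obj

/-! ### The two TBoxes -/

/-- The binary predicate that encodes a pointer. All predicates of the first TBox have even indices,
so that the odd ones are free for the second TBox. -/
def Ptr.index : Ptr → ℕ
  | inp => 0
  | out => 2
  | hd => 4
  | tl => 6
  | pred => 8
  | fst => 10
  | snd => 12

theorem Ptr.index_injective : Function.Injective Ptr.index := by
  intro p q h
  cases p <;> cases q <;> first | rfl | cases h

def Ptr.all : List Ptr := [inp, out, hd, tl, pred, fst, snd]

theorem Ptr.mem_all (p : Ptr) : p ∈ Ptr.all := by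
  cases p <;> simp [Ptr.all]

/-- The unary predicate that encodes a mark. The index `8` is that of `lastName`. -/
def Mark.index : Mark → ℕ
  | zero => 0
  | succ => 2
  | nil => 4
  | root => 6
  | code c => 2 * codeIndex c + 10

theorem Mark.index_injective : Function.Injective Mark.index := by
  intro m m' h
  cases m <;> cases m' <;> simp only [Mark.index] at h <;> first | rfl | omega | skip
  rename_i c d
  rw [codeIndex_injective (show codeIndex c = codeIndex d by omega)]

/-- The role that leads to the outermost call. -/
def rootRole : ℕ := 14

/-- The role of a chain through all elements. It and `lastName` serve to make the elements of a
finite model definable. -/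
def nextRole : ℕ := 16

/-- The concept name of the end of that chain. -/
def lastName : ℕ := 8

/-- A fresh role that selects an outermost call. -/
def startRole : ℕ := 1

/-- The fresh concept name that tells apart the two ends of a violated path equation. -/
def splitName : ℕ := 1

/-- The fresh concept name for calls of `c` from which a failure is reachable. -/
def failName (c : Code) : ℕ := 2 * codeIndex c + 3

theorem Ptr.index_even (p : Ptr) : p.index % 2 = 0 := by cases p <;> rfl

theorem Mark.index_even (m : Mark) : m.index % 2 = 0 := by cases m <;> simp [Mark.index]

namespace Concept

/-- The concept `∃ p₁. … ∃ pₖ. C`. -/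
def pathEx (π : List Ptr) (C : Concept) : Concept := π.foldr (fun p C => .ex p.index C) C

/-- The concept `∀ p₁. … ∀ pₖ. C`. -/
def pathAll (π : List Ptr) (C : Concept) : Concept := .neg (pathEx π (.neg C))

/-- The disjunction of a list of concepts. -/
def disj : List Concept → Concept
  | [] => .neg .top
  | C :: l => .neg (.inf (.neg C) (.neg (disj l)))

/-- The concept of the elements that carry the mark `m`. -/
def mark (m : Mark) : Concept := .name m.index

/-- The concept of the elements that satisfy the guard `g`. -/
def guard (g : Guard) : Concept := pathEx g.path (mark g.mark)

/-- The concept of the elements that represent the number `n`. -/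
def number : ℕ → Concept
  | 0 => mark .zero
  | n + 1 => .inf (mark .succ) (pathAll [.pred] (number n))

/-- The concept of the calls with input `[n]`. -/
def inputIs (n : ℕ) : Concept :=
  pathAll [.inp] (.inf (pathAll [.hd] (number n)) (pathAll [.tl] (mark .nil)))

end Concept

/-- A marking rule as a concept inclusion. -/
def Rule.inclusion (r : Rule) : Concept × Concept :=
  (.inf (.mark r.src) (.guard r.guard), .pathAll r.path (.mark r.tgt))

/-- The marks that are used in evaluation trees of `c`. -/
def marks (c : Code) : List Mark := .zero :: .succ :: .nil :: .root :: (subcodes c).map .code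

/-- The part of the first TBox that does not depend on the input. -/
def baseTBox (c : Code) : TBox :=
  [(.top, .ex rootRole (.mark .root)), (.top, .ex nextRole .top), (.name lastName, .top)] ++
    (Ptr.all.map fun p => (.top, .ex p.index .top)) ++ ((marks c).map fun m => (.mark m, .top)) ++
    (rules c).map Rule.inclusion

/-- The first TBox: there is a marked evaluation tree of `c` on the input `[n]`. It does not say
that the path equations hold, nor that the tree is finite. -/
def treeTBox (c : Code) (n : ℕ) : TBox := (.mark .root, .inputIs n) :: baseTBox c

/-- The second TBox: from some outermost call one gets to a violated path equation along recursive
calls, or there is an infinite path of recursive calls. -/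
def failTBox (c : Code) : TBox :=
  (.top, .ex startRole (.inf (.mark .root) (.name (failName c)))) ::
    (subcodes c).map fun d => (.name (failName d), .disj
      (((pathEqs d).map fun e => .inf (.guard e.guard)
        (.inf (.pathEx e.lhs (.name splitName)) (.pathEx e.rhs (.neg (.name splitName))))) ++
      (calls d).map fun k => .inf (.guard k.guard) (.ex k.ptr.index (.name (failName k.code)))))

/-! ### The semantics of the two TBoxes -/

/-- The pointers and marks of a structure. -/
abbrev Interp.ofStructure (X : Type) [predLang.Structure X] : Interp X where
  rel p x y := Bi p.index x y
  mark m x := Un m.index x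

namespace Concept

variable {X : Type} [predLang.Structure X]

theorem mem_pathEx {π : List Ptr} {C : Concept} {x : X} :
    x ∈ (pathEx π C).ext X ↔ ∃ y, (Interp.ofStructure X).Path π x y ∧ y ∈ C.ext X := by
  induction π generalizing x with
  | nil => exact ⟨fun h => ⟨x, rfl, h⟩, fun ⟨y, h, h'⟩ => by rwa [show x = y from h]⟩
  | cons p π ih =>
    constructor
    · rintro ⟨z, hz, hp⟩
      obtain ⟨y, hy, hC⟩ := ih.1 hz
      exact ⟨y, ⟨z, hp, hy⟩, hC⟩
    · rintro ⟨y, ⟨z, hp, hy⟩, hC⟩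
      exact ⟨z, ih.2 ⟨y, hy, hC⟩, hp⟩

theorem mem_pathAll {π : List Ptr} {C : Concept} {x : X} :
    x ∈ (pathAll π C).ext X ↔ ∀ y, (Interp.ofStructure X).Path π x y → y ∈ C.ext X := by
  have h : x ∈ (pathAll π C).ext X ↔ ¬ x ∈ (pathEx π (.neg C)).ext X := Iff.rfl
  have h' (y : X) : y ∈ (neg C).ext X ↔ ¬ y ∈ C.ext X := Iff.rfl
  simp only [h, mem_pathEx, h', not_exists, not_and, not_not]

theorem mem_disj {l : List Concept} {x : X} : x ∈ (disj l).ext X ↔ ∃ C ∈ l, x ∈ C.ext X := by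
  induction l with
  | nil => simp [disj, ext]
  | cons C l ih =>
    have h : x ∈ (disj (C :: l)).ext X ↔ ¬ (¬ x ∈ C.ext X ∧ ¬ x ∈ (disj l).ext X) := Iff.rfl
    rw [h, ih]
    simp only [List.mem_cons, exists_eq_or_imp, not_and_or, not_not]

theorem mem_guard {g : Guard} {x : X} :
    x ∈ (guard g).ext X ↔ (Interp.ofStructure X).GuardHolds g x := mem_pathEx

theorem mem_number {n : ℕ} {x : X} :
    x ∈ (number n).ext X ↔ (Interp.ofStructure X).RepNum n x := by
  induction n generalizing x with
  | zero => rfl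
  | succ n ih =>
    refine and_congr Iff.rfl (mem_pathAll.trans ?_)
    simp [Interp.Path, ih]

theorem mem_inputIs {n : ℕ} {x : X} : x ∈ (inputIs n).ext X ↔
    ∀ y, Bi Ptr.inp.index x y → (Interp.ofStructure X).RepList [n] y := by
  have h (y : X) : y ∈ (inf (pathAll [.hd] (number n)) (pathAll [.tl] (mark .nil))).ext X ↔
      (Interp.ofStructure X).RepList [n] y := by
    refine and_congr (mem_pathAll.trans ?_) (mem_pathAll.trans ?_)
    · simp [Interp.Path, mem_number]
    · simp only [Interp.Path, exists_eq_right]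
      rfl
  rw [inputIs, mem_pathAll]
  simp [Interp.Path, h]

end Concept

theorem isModel_treeTBox {X : Type} [predLang.Structure X] {c : Code} {n : ℕ} :
    (treeTBox c n).IsModel X ↔
      (∀ x : X, Un Mark.root.index x →
        ∀ y, Bi Ptr.inp.index x y → (Interp.ofStructure X).RepList [n] y) ∧
      (∀ x : X, ∃ y, Bi rootRole x y ∧ Un Mark.root.index y) ∧ (∀ x : X, ∃ y, Bi nextRole x y) ∧
      (Interp.ofStructure X).Total ∧ ∀ r ∈ rules c, (Interp.ofStructure X).RuleHolds r := by
  have top (C : Concept) : C.ext X ⊆ Concept.top.ext X := Set.subset_univ _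
  have ex (r : ℕ) (C : Concept) :
      Concept.top.ext X ⊆ (Concept.ex r C).ext X ↔ ∀ x : X, ∃ y, Bi r x y ∧ y ∈ C.ext X :=
    ⟨fun h x => let ⟨y, h1, h2⟩ := h (Set.mem_univ x); ⟨y, h2, h1⟩,
      fun h x _ => let ⟨y, h1, h2⟩ := h x; ⟨y, h2, h1⟩⟩
  have rule (r : Rule) : r.inclusion.1.ext X ⊆ r.inclusion.2.ext X ↔
      (Interp.ofStructure X).RuleHolds r := by
    have (x : X) : x ∈ r.inclusion.1.ext X ↔
        Un r.src.index x ∧ (Interp.ofStructure X).GuardHolds r.guard x :=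
      and_congr Iff.rfl Concept.mem_guard
    have h (x : X) : x ∈ r.inclusion.2.ext X ↔
        ∀ y, (Interp.ofStructure X).Path r.path x y → Un r.tgt.index y := Concept.mem_pathAll
    simp only [Set.subset_def, this, and_imp, h]
    rfl
  have start : (Concept.mark .root).ext X ⊆ (Concept.inputIs n).ext X ↔ ∀ x : X,
      Un Mark.root.index x →
        ∀ y, Bi Ptr.inp.index x y → (Interp.ofStructure X).RepList [n] y := by
    simp only [Set.subset_def, Concept.mem_inputIs]
    rfl
  simp only [TBox.IsModel, treeTBox, baseTBox, List.forall_mem_cons, List.forall_mem_append,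
    List.forall_mem_map, top, ex, rule, start, List.not_mem_nil, false_imp_iff, implies_true,
    and_true, and_assoc]
  refine and_congr Iff.rfl (and_congr Iff.rfl (and_congr ?_ (and_congr ?_ Iff.rfl)))
  · exact forall_congr' fun x => exists_congr fun y => and_iff_left (Set.mem_univ y)
  · exact ⟨fun h p x => (h p p.mem_all x).imp fun _ h => h.1,
      fun h p _ x => (h p x).imp fun y h => ⟨h, Set.mem_univ y⟩⟩

theorem isModel_failTBox {X : Type} [predLang.Structure X] {c : Code} :
    (failTBox c).IsModel X ↔
      (∀ x : X, ∃ y, Bi startRole x y ∧ Un Mark.root.index y ∧ Un (failName c) y) ∧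
      ∀ d ∈ subcodes c, ∀ x : X, Un (failName d) x →
        (∃ e ∈ pathEqs d, (Interp.ofStructure X).GuardHolds e.guard x ∧
          (∃ y, (Interp.ofStructure X).Path e.lhs x y ∧ Un splitName y) ∧
          ∃ z, (Interp.ofStructure X).Path e.rhs x z ∧ ¬ Un splitName z) ∨
        ∃ k ∈ calls d, (Interp.ofStructure X).GuardHolds k.guard x ∧
          ∃ y, Bi k.ptr.index x y ∧ Un (failName k.code) y := by
  have ex (r : ℕ) (C : Concept) (x : X) :
      x ∈ (Concept.ex r C).ext X ↔ ∃ y, Bi r x y ∧ y ∈ C.ext X :=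
    ⟨fun ⟨y, h1, h2⟩ => ⟨y, h2, h1⟩, fun ⟨y, h1, h2⟩ => ⟨y, h2, h1⟩⟩
  have inf (C D : Concept) (x : X) : x ∈ (Concept.inf C D).ext X ↔ x ∈ C.ext X ∧ x ∈ D.ext X :=
    Iff.rfl
  have neg (C : Concept) (x : X) : x ∈ (Concept.neg C).ext X ↔ ¬ x ∈ C.ext X := Iff.rfl
  have name (k : ℕ) (x : X) : x ∈ (Concept.name k).ext X ↔ Un k x := Iff.rfl
  have top (x : X) : x ∈ Concept.top.ext X := Set.mem_univ x
  simp only [TBox.IsModel, failTBox, List.forall_mem_cons, List.forall_mem_map]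
  simp only [Set.subset_def, top, ex, inf, name, Concept.mark, Concept.mem_disj, List.mem_append,
    or_and_right, exists_or,
    List.mem_map, exists_exists_and_eq_and, Concept.mem_guard, Concept.mem_pathEx, neg,
    true_imp_iff]

/-- The first TBox does not use the fresh predicates, whose indices are odd. -/
theorem even_of_mem_sig_treeTBox {c : Code} {n : ℕ} {p : Predicate}
    (h : p ∈ (treeTBox c n).sig) : p.1 % 2 = 0 := by
  have hm (m : Mark) : p ∈ (Concept.mark m).sig → p.1 % 2 = 0 := by
    intro h
    rw [Finset.mem_singleton.1 h]
    exact m.index_even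
  have hex (π : List Ptr) (C : Concept) (hC : p ∈ C.sig → p.1 % 2 = 0) :
      p ∈ (Concept.pathEx π C).sig → p.1 % 2 = 0 := by
    induction π with
    | nil => exact hC
    | cons q π ih =>
      intro h
      rcases Finset.mem_insert.1 h with rfl | h
      · exact q.index_even
      · exact ih h
  have hn (n : ℕ) : p ∈ (Concept.number n).sig → p.1 % 2 = 0 := by
    induction n with
    | zero => exact hm _
    | succ n ih => exact fun h => (Finset.mem_union.1 h).elim (hm _) (hex _ _ ih)
  have hT (T : TBox) (hC : ∀ q ∈ T, (p ∈ q.1.sig → p.1 % 2 = 0) ∧ (p ∈ q.2.sig → p.1 % 2 = 0)) :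
      p ∈ T.sig → p.1 % 2 = 0 := by
    induction T with
    | nil => simp [TBox.sig]
    | cons q T ih =>
      rw [List.forall_mem_cons] at hC
      simp only [TBox.sig, Finset.mem_union]
      rintro ((h | h) | h)
      · exact hC.1.1 h
      · exact hC.1.2 h
      · exact ih hC.2 h
  have htop : p ∈ Concept.top.sig → p.1 % 2 = 0 := by simp [Concept.sig]
  have hex1 (r : ℕ) (hr : r % 2 = 0) (C : Concept) (hC : p ∈ C.sig → p.1 % 2 = 0) :
      p ∈ (Concept.ex r C).sig → p.1 % 2 = 0 := by
    intro h
    rcases Finset.mem_insert.1 h with rfl | h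
    · exact hr
    · exact hC h
  have hlast : p ∈ (Concept.name lastName).sig → p.1 % 2 = 0 := by
    intro h
    rw [Finset.mem_singleton.1 h]
    rfl
  refine hT _ ?_ h
  simp only [treeTBox, baseTBox, List.forall_mem_cons, List.forall_mem_append, List.forall_mem_map,
    List.not_mem_nil, false_imp_iff, implies_true, and_true]
  refine ⟨⟨hm _, hex [.inp] _ fun h => ?_⟩, ⟨⟨⟨⟨htop, hex1 _ rfl _ (hm _)⟩,
    ⟨htop, hex1 _ rfl _ htop⟩, hlast, htop⟩, fun q _ => ⟨htop, hex1 _ q.index_even _ htop⟩⟩,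
    fun m _ => ⟨hm m, htop⟩⟩, fun r _ => ⟨fun h => ?_, hex _ _ (hm _)⟩⟩
  · exact (Finset.mem_union.1 h).elim (hex [.hd] _ (hn n)) (hex [.tl] _ (hm _))
  · exact (Finset.mem_union.1 h).elim (hm _) (hex _ _ (hm _))

theorem TBox.left_mem_sig {T : TBox} {q : Concept × Concept} (hq : q ∈ T) {p : Predicate}
    (hp : p ∈ q.1.sig) : p ∈ T.sig := by
  induction T with
  | nil => cases hq
  | cons q' T ih =>
    rcases List.mem_cons.1 hq with rfl | hq
    · simp [TBox.sig, hp]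
    · simp [TBox.sig, ih hq]

theorem TBox.right_mem_sig {T : TBox} {q : Concept × Concept} (hq : q ∈ T) {p : Predicate}
    (hp : p ∈ q.2.sig) : p ∈ T.sig := by
  induction T with
  | nil => cases hq
  | cons q' T ih =>
    rcases List.mem_cons.1 hq with rfl | hq
    · simp [TBox.sig, hp]
    · simp [TBox.sig, ih hq]

theorem mark_mem_sig_baseTBox {c : Code} {m : Mark} (hm : m ∈ marks c) :
    (m.index, 1) ∈ (baseTBox c).sig := by
  refine TBox.left_mem_sig (q := (.mark m, .top)) ?_ (by simp [Concept.sig, Concept.mark])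
  simp only [baseTBox, List.mem_append]
  exact .inl (.inr (List.mem_map_of_mem hm))

theorem ptr_mem_sig_baseTBox (c : Code) (p : Ptr) : (p.index, 2) ∈ (baseTBox c).sig := by
  refine TBox.right_mem_sig (q := (.top, .ex p.index .top)) ?_ (by simp [Concept.sig])
  simp only [baseTBox, List.mem_append]
  exact .inl (.inl (.inr (List.mem_map_of_mem p.mem_all)))

/-- The signature of the first TBox does not depend on the input. -/
theorem sig_treeTBox (c : Code) (n : ℕ) : (treeTBox c n).sig = (baseTBox c).sig := by
  have hmark {m : Mark} (hm : m ∈ marks c) : (m.index, 1) ∈ (baseTBox c).sig :=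
    mark_mem_sig_baseTBox hm
  have hptr := ptr_mem_sig_baseTBox c
  have hnum (k : ℕ) : (Concept.number k).sig ⊆ (baseTBox c).sig := by
    induction k with
    | zero =>
      simp only [Concept.number, Concept.mark, Concept.sig, Finset.singleton_subset_iff]
      exact hmark (m := .zero) (by simp [marks])
    | succ k ih =>
      simp only [Concept.number, Concept.mark, Concept.pathAll, Concept.pathEx, List.foldr_cons,
        List.foldr_nil, Concept.sig, Finset.union_subset_iff, Finset.singleton_subset_iff,
        Finset.insert_subset_iff]
      exact ⟨hmark (m := .succ) (by simp [marks]), hptr .pred, ih⟩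
  rw [treeTBox, TBox.sig, Finset.union_eq_right]
  simp only [Concept.inputIs, Concept.mark, Concept.pathAll, Concept.pathEx, List.foldr_cons,
    List.foldr_nil, Concept.sig, Finset.union_subset_iff, Finset.singleton_subset_iff,
    Finset.insert_subset_iff]
  exact ⟨hmark (m := .root) (by simp [marks]), hptr .inp, ⟨hptr .hd, hnum n⟩, hptr .tl,
    hmark (m := .nil) (by simp [marks])⟩

/-! ### Diverging computations: every model of the first TBox expands to the second -/

/-- The expansion of a structure by interpretations of the fresh predicates. -/
abbrev expansion {X : Type} (s : predLang.Structure X) (split : X → Prop) (fail : Code → X → Prop)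
    (start : X) : predLang.Structure X :=
  mkStructure
    (fun k x => if k % 2 = 0 then @Un X s k x else if k = splitName then split x
      else ∃ d, k = failName d ∧ fail d x)
    (fun r x y => if r % 2 = 0 then @Bi X s r x y else y = start)

/-- If the computation diverges, then each model of the first TBox can be expanded by fresh
predicates to a model of the second one. -/
theorem exists_expansion {X : Type} [Nonempty X] (s : predLang.Structure X) {c : Code} {n : ℕ}
    (hs : (treeTBox c n).IsModel X) (hc : ¬ (c.eval [n]).Dom) :
    ∃ t : predLang.Structure X, AgreeOn (treeTBox c n).sig t s ∧
      @TBox.IsModel (failTBox c) X t := by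
  obtain ⟨hin, hroot, -, htot, hrules⟩ := isModel_treeTBox.1 hs
  obtain ⟨x₀⟩ := ‹Nonempty X›
  obtain ⟨r, -, hr⟩ := hroot x₀
  -- it suffices to find failing calls, and one set that separates the ends of violated paths
  -- (one set is enough, as only one violated equation is ever used)
  suffices H : ∃ (split : X → Prop) (fail : Code → X → Prop), fail c r ∧
      ∀ d ∈ subcodes c, ∀ x : X, fail d x →
        (∃ e ∈ pathEqs d, (Interp.ofStructure X).GuardHolds e.guard x ∧
          (∃ y, (Interp.ofStructure X).Path e.lhs x y ∧ split y) ∧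
          ∃ z, (Interp.ofStructure X).Path e.rhs x z ∧ ¬ split z) ∨
        ∃ k ∈ calls d, (Interp.ofStructure X).GuardHolds k.guard x ∧
          ∃ y, Bi k.ptr.index x y ∧ fail k.code y by
    obtain ⟨split, fail, h1, h2⟩ := H
    refine ⟨expansion s split fail r, ?_, ?_⟩
    · rintro R m hRm xs
      have he := even_of_mem_sig_treeTBox hRm
      rcases TBox.arity_of_mem_sig hRm with h | h <;> simp only at h he <;> subst h
      · change (if R % 2 = 0 then @Un X s R (xs 0) else _) ↔ _
        rw [if_pos he, Un, show ![xs 0] = xs from by funext i; fin_cases i; rfl]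
      · change (if R % 2 = 0 then @Bi X s R (xs 0) (xs 1) else _) ↔ _
        rw [if_pos he, Bi, show ![xs 0, xs 1] = xs from by funext i; fin_cases i <;> rfl]
    · have hI : @Interp.ofStructure X (expansion s split fail r) = @Interp.ofStructure X s := by
        refine (Interp.mk.injEq _ _ _ _).mpr ⟨?_, ?_⟩
        · funext p x y
          exact if_pos p.index_even
        · funext m x
          exact if_pos m.index_even
      have hbi (r' : ℕ) (h : r' % 2 = 0) (x y : X) :
          @Bi X (expansion s split fail r) r' x y = @Bi X s r' x y := if_pos h
      have hun (k : ℕ) (h : k % 2 = 0) (x : X) :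
          @Un X (expansion s split fail r) k x = @Un X s k x := if_pos h
      have hstart (x y : X) : @Bi X (expansion s split fail r) startRole x y = (y = r) :=
        if_neg (by decide)
      have hsplit (x : X) : @Un X (expansion s split fail r) splitName x = split x :=
        (if_neg (by decide)).trans (if_pos rfl)
      have hfail (d : Code) (x : X) :
          @Un X (expansion s split fail r) (failName d) x = fail d x := by
        refine (if_neg ?_).trans ((if_neg ?_).trans (propext ⟨?_, fun h => ⟨d, rfl, h⟩⟩))
        · simp only [failName]
          omega
        · simp [failName, splitName]
        · rintro ⟨d', hd, h⟩
          simp only [failName, Nat.add_right_cancel_iff, Nat.mul_right_inj, ne_eq,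
            OfNat.ofNat_ne_zero, not_false_eq_true] at hd
          rwa [codeIndex_injective hd]
      rw [@isModel_failTBox X (expansion s split fail r) c, hI]
      simp only [hstart, hsplit, hfail, hun _ (Mark.index_even _), hbi _ (Ptr.index_even _)]
      exact ⟨fun _ => ⟨r, rfl, hr, h1⟩, h2⟩
  let I := Interp.ofStructure X
  have hgood : ¬ I.Good c r := fun hg => by
    have hmark : I.mark (.code c) r :=
      hrules ⟨.root, ⟨[], .root⟩, [], .code c⟩ (by simp [rules]) r hr ⟨r, rfl, hr⟩ r rfl
    obtain ⟨w, hw, -⟩ := hg.sound htot hrules (self_mem_subcodes c) hmark (v := [n]) (hin r hr)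
    exact hc (Part.dom_iff_mem.2 ⟨w, hw⟩)
  let Step (a b : Code × X) : Prop :=
    ∃ k ∈ calls a.1, I.GuardHolds k.guard a.2 ∧ I.rel k.ptr a.2 b.2 ∧ k.code = b.1
  by_cases hdef : ∃ a : Code × X, Relation.ReflTransGen Step (c, r) a ∧
      ∃ e ∈ pathEqs a.1, I.GuardHolds e.guard a.2 ∧
        ∃ y z, I.Path e.lhs a.2 y ∧ I.Path e.rhs a.2 z ∧ y ≠ z
  · -- one violated equation is reachable: the failing calls are those from which it is reachable
    obtain ⟨a, ha, e, he, hg, y, z, hy, hz, hne⟩ := hdef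
    refine ⟨(· = y), fun d x => Relation.ReflTransGen Step (d, x) a, ha, fun d _ x hx => ?_⟩
    rcases hx.cases_head with rfl | ⟨⟨d', x'⟩, ⟨k, hk, hkg, hkr, rfl⟩, hx'⟩
    · exact .inl ⟨e, he, hg, ⟨y, hy, rfl⟩, z, hz, hne.symm⟩
    · exact .inr ⟨k, hk, hkg, x', hkr, hx'⟩
  · -- no violated equation is reachable, so the reachable calls that are not good fail forever
    refine ⟨fun _ => True, fun d x => Relation.ReflTransGen Step (c, r) (d, x) ∧ ¬ I.Good d x,
      ⟨.refl, hgood⟩, fun d _ x ⟨hx, hng⟩ => .inr ?_⟩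
    by_contra hno
    refine hng (.intro (fun e he hg y z hy hz => ?_) fun k hk hg y hy => ?_)
    · by_contra hne
      exact hdef ⟨(d, x), hx, e, he, hg, y, z, hy, hz, hne⟩
    · by_contra hyg
      exact hno ⟨k, hk, hg, y, hy, hx.tail ⟨k, hk, hg, hy, rfl⟩, hyg⟩

/-! ### Terminating computations: a finite evaluation tree separates the TBoxes -/

theorem guard_mark_mem_of_pathEqs {c d : Code} (hd : d ∈ subcodes c) {e : PathEq}
    (he : e ∈ pathEqs d) : e.guard.mark ∈ marks c := by
  have : e.guard.mark = .zero ∨ e.guard.mark = .succ ∨ e.guard.mark = .code d := by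
    cases d <;> simp only [pathEqs, List.mem_cons, List.not_mem_nil, or_false] at he <;>
      rcases he with rfl | rfl | rfl | rfl <;> simp [trivGuard]
  rcases this with h | h | h <;> simp [h, marks, hd]

theorem guard_mark_mem_of_calls {c d : Code} (hd : d ∈ subcodes c) {k : Call}
    (hk : k ∈ calls d) : k.guard.mark ∈ marks c := by
  have : k.guard.mark = .zero ∨ k.guard.mark = .succ ∨ k.guard.mark = .code d := by
    cases d <;> simp only [calls, List.mem_cons, List.not_mem_nil, or_false] at hk <;>
      rcases hk with rfl | rfl <;> simp [trivGuard]
  rcases this with h | h | h <;> simp [h, marks, hd]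

/-- If a structure maps injectively into an evaluation tree such that pointers and marks are
preserved, then no element of it that is mapped to a good call can be marked as failing. -/
theorem not_fail_of_good {X Y : Type} [predLang.Structure X] {c : Code}
    (hX : (failTBox c).IsModel X) {I : Interp Y} {h : X → Y} (hinj : Function.Injective h)
    (hrel : ∀ p x y, Bi p.index x y → I.rel p (h x) (h y))
    (hmark : ∀ m ∈ marks c, ∀ x, Un m.index x → I.mark m (h x))
    {d : Code} {y : Y} (hy : I.Good d y) (hd : d ∈ subcodes c) :
    ∀ x : X, h x = y → ¬ Un (failName d) x := by
  induction hy with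
  | @intro d _ eqs sub ih =>
    rintro x rfl hx
    have hg {g : Guard} (hgm : g.mark ∈ marks c) :
        (Interp.ofStructure X).GuardHolds g x → I.GuardHolds g (h x) :=
      fun ⟨y, hy, hym⟩ => ⟨h y, hy.map hrel, hmark _ hgm _ hym⟩
    rcases (isModel_failTBox.1 hX).2 d hd x hx with
      ⟨e, he, heg, ⟨y, hy, hys⟩, z, hz, hzs⟩ | ⟨k, hk, hkg, y, hy, hyf⟩
    · have := hinj (eqs e he (hg (guard_mark_mem_of_pathEqs hd he) heg) _ _
        (hy.map hrel) (hz.map hrel))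
      exact hzs (this ▸ hys)
    · exact ih k hk (hg (guard_mark_mem_of_calls hd hk) hkg) (h y) (hrel _ _ _ hy)
        (calls_subcodes hd k hk) y rfl hyf

/-- A finite closed part of the standard evaluation tree as a structure, with a chain through its
elements. The truncated subtraction makes the end of the chain its own successor,
so that `nextRole` is total. -/
abbrev Obj.toStructure (c : Code) (n : ℕ) (S : Set Obj) {N : ℕ} (e : S ≃ Fin N) :
    predLang.Structure S :=
  mkStructure
    (fun k a => (∃ m : Mark, k = m.index ∧ Obj.HasMark c n m a) ∨ k = lastName ∧ (e a : ℕ) = 0)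
    (fun r a b => (∃ p : Ptr, r = p.index ∧ Obj.step p a = b) ∨
      r = rootRole ∧ b.1 = .call c [n] ∨ r = nextRole ∧ (e b : ℕ) = e a - 1)

/-- If the computation terminates, then some two-variable sentence over the signature of the first
TBox is a consequence of both TBoxes, but not of the first one. -/
theorem exists_separator {c : Code} {n : ℕ} (h : Terminates c [n]) :
    ∃ ψ : Formula, ψ.Within ∅ (treeTBox c n).sig ∧
      TBox.Consequence (treeTBox c n ++ failTBox c) ψ ∧ ¬ (treeTBox c n).Consequence ψ := by
  obtain ⟨S, hfin, hclosed, hmem⟩ := Obj.finitelyGenerated_call h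
  have := hfin.to_subtype
  let e : S ≃ Fin (Nat.card S) := Finite.equivFin S
  let st : predLang.Structure S := Obj.toStructure c n S e
  have hmark (m : Mark) (a : S) : Un m.index a ↔ Obj.HasMark c n m a := by
    constructor
    · rintro (⟨m', hm, h⟩ | ⟨h, -⟩)
      · rwa [Mark.index_injective hm]
      · exfalso
        cases m <;> simp only [Mark.index, lastName] at h <;> omega
    · exact fun h => .inl ⟨m, rfl, h⟩
  have hrel (p : Ptr) (a b : S) : Bi p.index a b ↔ Obj.step p a = b := by
    constructor
    · rintro (⟨p', hp, h⟩ | ⟨h, -⟩ | ⟨h, -⟩)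
      · rwa [Ptr.index_injective hp]
      · cases p <;> cases h
      · cases p <;> cases h
    · exact fun h => .inl ⟨p, rfl, h⟩
  have hlast (a : S) : Un lastName a ↔ (e a : ℕ) = 0 := by
    constructor
    · rintro (⟨m, h, -⟩ | ⟨-, h⟩)
      · exfalso
        cases m <;> simp only [Mark.index, lastName] at h <;> omega
      · exact h
    · exact fun h => .inr ⟨rfl, h⟩
  have hnext (a b : S) : Bi nextRole a b ↔ (e b : ℕ) = e a - 1 := by
    constructor
    · rintro (⟨p, h, -⟩ | ⟨h, -⟩ | ⟨-, h⟩)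
      · cases p <;> cases h
      · cases h
      · exact h
    · exact fun h => .inr (.inr ⟨rfl, h⟩)
  have hpath {π : List Ptr} {a b : S} (hab : (Interp.ofStructure S).Path π a b) :
      (Obj.interp c n).Path π a.1 b.1 := hab.map fun p x y => (hrel p x y).1
  have hnum (k : ℕ) : ∀ a : S, a.1 = .num k → (Interp.ofStructure S).RepNum k a := by
    induction k with
    | zero => exact fun a ha => (hmark .zero a).2 ha
    | succ k ih =>
      refine fun a ha => ⟨(hmark .succ a).2 ⟨k, ha⟩, fun b hb => ih b ?_⟩
      rw [← (hrel _ _ _).1 hb, ha]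
      rfl
  have hmodel : (treeTBox c n).IsModel S := by
    refine isModel_treeTBox.2 ⟨fun x hx y hy => ?_, fun _ => ⟨⟨_, hmem⟩, .inr (.inl ⟨rfl, rfl⟩),
      (hmark .root _).2 rfl⟩, fun x => ?_, fun p x => ⟨⟨_, hclosed p _ x.2⟩, (hrel _ _ _).2 rfl⟩,
      fun r hr x hx ⟨y, hy, hym⟩ z hz => ?_⟩
    · have hx : x.1 = .call c [n] := (hmark .root x).1 hx
      have hy : Obj.lst [n] = y.1 := by
        rw [← (hrel _ _ _).1 hy, hx]
        rfl
      refine ⟨fun z hz => hnum n z ?_, fun z hz => (hmark .nil z).2 ?_⟩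
      · rw [← (hrel _ _ _).1 hz, ← hy]
        rfl
      · rw [← (hrel _ _ _).1 hz, ← hy]
        rfl
    · exact ⟨e.symm ⟨e x - 1, by have := (e x).2; omega⟩,
        (hnext _ _).2 (by rw [e.apply_symm_apply])⟩
    · exact (hmark _ _).2 (Obj.ruleHolds c h r hr x.1 ((hmark _ _).1 hx)
        ⟨y.1, hpath hy, (hmark _ _).1 hym⟩ z.1 (hpath hz))
  obtain ⟨χ, hχ, hχS, hχX⟩ := exists_diagram e hlast hnext ((marks c).map Mark.index)
    (Ptr.all.map Ptr.index) (S := (treeTBox c n).sig)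
    (by
      rw [sig_treeTBox]
      exact TBox.left_mem_sig (q := (.name lastName, .top)) (by simp [baseTBox])
        (by simp [Concept.sig]))
    (by
      rw [sig_treeTBox]
      exact TBox.right_mem_sig (q := (.top, .ex nextRole .top)) (by simp [baseTBox])
        (by simp [Concept.sig]))
    (by
      rw [sig_treeTBox, List.forall_mem_map]
      exact fun m hm => mark_mem_sig_baseTBox hm)
    (by
      rw [sig_treeTBox, List.forall_mem_map]
      exact fun p _ => ptr_mem_sig_baseTBox c p)
  refine ⟨.neg χ, hχ.neg, fun X _ v hX hv => ?_, fun hcons => ?_⟩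
  · obtain ⟨g, hinj, hgm, hgr⟩ := hχX X v hv
    simp only [List.forall_mem_map] at hgm hgr
    have hXf : (failTBox c).IsModel X := fun p hp => hX p (List.mem_append_right _ hp)
    obtain ⟨x, -, hx, hxf⟩ := (isModel_failTBox.1 hXf).1 (v 0)
    have hgx : (g x).1 = .call c [n] := (hmark .root _).1 (hgm .root (by simp [marks]) x hx)
    exact not_fail_of_good hXf (I := Obj.interp c n) (h := fun x => (g x).1)
      (Subtype.val_injective.comp hinj) (fun p x y hxy => (hrel _ _ _).1 (hgr p p.mem_all x y hxy))
      (fun m hm x hx => (hmark _ _).1 (hgm m hm x hx)) (Obj.good_call c n h)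
      (self_mem_subcodes c) x hgx hxf
  · exact hcons S (fun _ => ⟨_, hmem⟩) hmodel (hχS _)

/-! ### Separation and conservativity of the sentences for the two TBoxes -/

/-- The sentence for both TBoxes. -/
def bothFormula (c : Code) (n : ℕ) : Formula :=
  .and (treeTBox c n).toFormula (failTBox c).toFormula

theorem bothFormula_consequence_iff {c : Code} {n : ℕ} {ψ : Formula} :
    (bothFormula c n).Consequence ψ ↔ TBox.Consequence (treeTBox c n ++ failTBox c) ψ := by
  have (X : Type) [predLang.Structure X] (v : ℕ → X) :
      (bothFormula c n).Holds v ↔ TBox.IsModel (treeTBox c n ++ failTBox c) X := by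
    simp only [bothFormula, Formula.Holds, TBox.holds_toFormula, TBox.IsModel,
      List.forall_mem_append]
  exact forall_congr' fun X => forall_congr' fun s => forall_congr' fun v =>
    imp_congr_left (this X v)

theorem toFormula_consequence_iff {T : TBox} {ψ : Formula} :
    T.toFormula.Consequence ψ ↔ T.Consequence ψ :=
  forall_congr' fun _ => forall_congr' fun _ => forall_congr' fun v =>
    imp_congr_left (T.holds_toFormula v)

/-- If the computation diverges, the second TBox has no new consequences, as long as the fresh
predicates are not used. -/
theorem consequence_of_diverges {c : Code} {n : ℕ} (h : ¬ Terminates c [n]) {ψ : Formula}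
    (hψ : ∀ p ∈ ψ.sig, p ∈ (failTBox c).sig → p ∈ (treeTBox c n).sig)
    (hc : TBox.Consequence (treeTBox c n ++ failTBox c) ψ) : (treeTBox c n).Consequence ψ := by
  intro X s v hX
  have : Nonempty X := ⟨v 0⟩
  obtain ⟨t, ht, htm⟩ := exists_expansion s hX fun hd =>
    h (terminates_of_mem (Part.get_mem hd))
  -- predicates outside the second TBox keep their meaning, also if the expansion has changed it
  have hmix (R m : ℕ) (hR : (R, m) ∈ (failTBox c).sig → (R, m) ∈ (treeTBox c n).sig)
      (xs : Fin m → X) :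
      (mixStructure (failTBox c).sig t s).RelMap R xs ↔ s.RelMap R xs := by
    by_cases hf : (R, m) ∈ (failTBox c).sig
    · exact (mixStructure_agree_left _ t s R m hf xs).trans (ht R m (hR hf) xs)
    · exact mixStructure_agree_right _ t s R m hf xs
  have h1 : @TBox.IsModel (treeTBox c n) X (mixStructure (failTBox c).sig t s) :=
    (TBox.isModel_congr fun R m hR xs => hmix R m (fun _ => hR) xs).2 hX
  have h2 : @TBox.IsModel (failTBox c) X (mixStructure (failTBox c).sig t s) :=
    (TBox.isModel_congr (mixStructure_agree_left _ t s)).2 htm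
  have h3 := @hc X (mixStructure (failTBox c).sig t s) v fun p hp =>
    (List.mem_append.1 hp).elim (h1 p) (h2 p)
  exact (Formula.holds_congr fun R m hR xs => hmix R m (hψ _ hR) xs).1 h3

theorem sigEntails_of_diverges (F : Set Formula) {c : Code} {n : ℕ} (h : ¬ Terminates c [n])
    {S : Finset Predicate} (hS : S ∩ (bothFormula c n).sig ⊆ (treeTBox c n).sig) :
    SigEntails F S (treeTBox c n).toFormula (bothFormula c n) := by
  intro ψ _ _ hψ hc
  rw [bothFormula_consequence_iff] at hc
  refine toFormula_consequence_iff.2 (consequence_of_diverges h (fun p hp hf => ?_) hc)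
  refine hS (Finset.mem_inter.2 ⟨hψ hp, ?_⟩)
  simp [bothFormula, Formula.sig, TBox.sig_toFormula, hf]

theorem sigEntails_iff {F : Set Formula} (hF : FO2 ⊆ F) (c : Code) (n : ℕ) :
    SigEntails F (treeTBox c n).sig (treeTBox c n).toFormula (bothFormula c n) ↔
      ¬ Terminates c [n] := by
  refine ⟨fun h ht => ?_, fun h => sigEntails_of_diverges F h Finset.inter_subset_left⟩
  obtain ⟨ψ, hψ, h1, h2⟩ := exists_separator ht
  exact h2 (toFormula_consequence_iff.1 (h ψ (hF (TBox.within_mem_FO2 hψ)) hψ.isSentence hψ.2.2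
    (bothFormula_consequence_iff.2 h1)))

theorem conservativeExt_iff {F : Set Formula} (hF : FO2 ⊆ F) (c : Code) (n : ℕ) :
    ConservativeExt F (treeTBox c n).toFormula (failTBox c).toFormula ↔ ¬ Terminates c [n] := by
  rw [ConservativeExt, TBox.sig_toFormula]
  exact sigEntails_iff hF c n

theorem sigInseparable_iff {F : Set Formula} (hF : FO2 ⊆ F) (c : Code) (n : ℕ) :
    SigInseparable F (treeTBox c n).sig (treeTBox c n).toFormula (bothFormula c n) ↔
      ¬ Terminates c [n] := by
  rw [SigInseparable, sigEntails_iff hF, and_iff_left]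
  exact fun ψ _ _ _ h X _ v hv => h X v hv.1

theorem stronglySigEntails_iff {F : Set Formula} (hF : FO2 ⊆ F) (c : Code) (n : ℕ) :
    StronglySigEntails F (treeTBox c n).sig (treeTBox c n).toFormula (bothFormula c n) ↔
      ¬ Terminates c [n] :=
  ⟨fun h => (sigEntails_iff hF c n).1 (h _ Finset.inter_subset_left),
    fun h _ hS => sigEntails_of_diverges F h hS⟩

theorem conservativeExt_tbox_iff (c : Code) (n : ℕ) :
    TBox.ConservativeExt FO2 (treeTBox c n) (failTBox c) ↔ ¬ Terminates c [n] := by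
  refine ⟨fun h ht => ?_, fun h ψ _ _ hψ => consequence_of_diverges h fun p hp _ => hψ hp⟩
  obtain ⟨ψ, hψ, h1, h2⟩ := exists_separator ht
  exact h2 (h ψ (TBox.within_mem_FO2 hψ) hψ.isSentence hψ.2.2 h1)

theorem TBox.isSentenceOf_toFormula {F : Set Formula} (hF : FO2 ⊆ F) (T : TBox) :
    IsSentenceOf F T.toFormula :=
  ⟨hF (TBox.within_mem_FO2 T.toFormula_within), T.toFormula_within.isSentence⟩

theorem isSentenceOf_bothFormula {F : Set Formula} (hF : FO2 ⊆ F) (c : Code) (n : ℕ) :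
    IsSentenceOf F (bothFormula c n) := by
  have h : (bothFormula c n).Within ∅ ((treeTBox c n).sig ∪ (failTBox c).sig) :=
    ((treeTBox c n).toFormula_within.mono subset_rfl Set.subset_union_left).and
      ((failTBox c).toFormula_within.mono subset_rfl Set.subset_union_right)
  exact ⟨hF ⟨h.1, fun p hp => (h.2.2 p hp).elim TBox.arity_of_mem_sig TBox.arity_of_mem_sig⟩,
    h.isSentence⟩

/-! ### Computability of the reductions -/

theorem Formula.primrec_neg : Primrec Formula.neg := by
  have h : Primrec fun n : ℕ => 5 * n + 2 :=
    Primrec.nat_add.comp (Primrec.nat_mul.comp (.const 5) .id) (.const 2)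
  refine ((Primrec.of_equiv_symm (e := equivNat)).comp
    (h.comp (Primrec.of_equiv (e := equivNat)))).of_eq fun φ => ?_
  exact equivNat.symm_apply_eq.2 rfl

theorem Formula.primrec_and : Primrec₂ Formula.and := by
  have h : Primrec fun p : ℕ × ℕ => 5 * Nat.pair p.1 p.2 + 3 :=
    Primrec.nat_add.comp (Primrec.nat_mul.comp (.const 5) (Primrec₂.natPair.comp .fst .snd))
      (.const 3)
  refine ((Primrec.of_equiv_symm (e := equivNat)).comp
    (h.comp (((Primrec.of_equiv (e := equivNat)).comp .fst).pair
      ((Primrec.of_equiv (e := equivNat)).comp .snd)))).of_eq fun φ => ?_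
  exact equivNat.symm_apply_eq.2 rfl

theorem Formula.primrec_ex (x : ℕ) : Primrec (Formula.ex x) := by
  have h : Primrec fun n : ℕ => 5 * Nat.pair x n + 4 :=
    Primrec.nat_add.comp (Primrec.nat_mul.comp (.const 5) (Primrec₂.natPair.comp (.const x) .id))
      (.const 4)
  refine ((Primrec.of_equiv_symm (e := equivNat)).comp
    (h.comp (Primrec.of_equiv (e := equivNat)))).of_eq fun φ => ?_
  exact equivNat.symm_apply_eq.2 rfl

theorem Concept.primrec_neg : Primrec Concept.neg := by
  have h : Primrec fun n : ℕ => 4 * n + 2 :=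
    Primrec.nat_add.comp (Primrec.nat_mul.comp (.const 4) .id) (.const 2)
  refine ((Primrec.of_equiv_symm (e := equivNat)).comp
    (h.comp (Primrec.of_equiv (e := equivNat)))).of_eq fun φ => ?_
  exact equivNat.symm_apply_eq.2 rfl

theorem Concept.primrec_inf : Primrec₂ Concept.inf := by
  have h : Primrec fun p : ℕ × ℕ => 4 * Nat.pair p.1 p.2 + 3 :=
    Primrec.nat_add.comp (Primrec.nat_mul.comp (.const 4) (Primrec₂.natPair.comp .fst .snd))
      (.const 3)
  refine ((Primrec.of_equiv_symm (e := equivNat)).comp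
    (h.comp (((Primrec.of_equiv (e := equivNat)).comp .fst).pair
      ((Primrec.of_equiv (e := equivNat)).comp .snd)))).of_eq fun φ => ?_
  exact equivNat.symm_apply_eq.2 rfl

theorem Concept.primrec_ex (r : ℕ) : Primrec (Concept.ex r) := by
  have h : Primrec fun n : ℕ => 4 * Nat.pair r n + 4 :=
    Primrec.nat_add.comp (Primrec.nat_mul.comp (.const 4) (Primrec₂.natPair.comp (.const r) .id))
      (.const 4)
  refine ((Primrec.of_equiv_symm (e := equivNat)).comp
    (h.comp (Primrec.of_equiv (e := equivNat)))).of_eq fun φ => ?_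
  exact equivNat.symm_apply_eq.2 rfl

theorem Concept.primrec_pathAll (p : Ptr) : Primrec (Concept.pathAll [p]) :=
  primrec_neg.comp ((primrec_ex p.index).comp primrec_neg)

theorem Concept.primrec_number : Primrec Concept.number := by
  have h : Primrec₂ fun (_ : ℕ) (C : Concept) => Concept.inf (.mark .succ) (.pathAll [.pred] C) :=
    primrec_inf.comp (.const _) ((primrec_pathAll .pred).comp .snd)
  refine (Primrec.nat_rec₁ (mark .zero) h).of_eq fun n => ?_
  induction n with
  | zero => rfl
  | succ n ih => exact congrArg (fun C => Concept.inf (.mark .succ) (.pathAll [.pred] C)) ih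

theorem Concept.primrec_inputIs : Primrec Concept.inputIs :=
  (primrec_pathAll .inp).comp
    (primrec_inf.comp ((primrec_pathAll .hd).comp primrec_number) (.const _))

theorem primrec_treeTBox (c : Code) : Primrec (treeTBox c) :=
  Primrec.list_cons.comp (Primrec.pair (.const _) Concept.primrec_inputIs) (.const _)

/-- The effect of a universal restriction on the standard translation. -/
theorem Formula.primrec_restrict (r : ℕ) : Primrec fun φ : Formula =>
    Formula.neg (.ex 1 (.and (.rel r [0, 1]) (Formula.shift (.neg φ)))) :=
  primrec_neg.comp ((primrec_ex 1).comp (primrec_and.comp (.const _)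
    ((primrec_ex 0).comp (primrec_and.comp (.const _) primrec_neg))))

theorem Concept.primrec_toFormula_number : Primrec fun n => (Concept.number n).toFormula := by
  have h : Primrec₂ fun (_ : ℕ) (φ : Formula) => Formula.and (mark .succ).toFormula
      (.neg (.ex 1 (.and (.rel Ptr.pred.index [0, 1]) (Formula.shift (.neg φ))))) :=
    Formula.primrec_and.comp (.const _) ((Formula.primrec_restrict _).comp .snd)
  refine (Primrec.nat_rec₁ (mark .zero).toFormula h).of_eq fun n => ?_
  induction n with
  | zero => rfl
  | succ n ih =>
    exact congrArg (fun φ => Formula.and (mark .succ).toFormula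
      (.neg (.ex 1 (.and (.rel Ptr.pred.index [0, 1]) (Formula.shift (.neg φ)))))) ih

theorem Concept.primrec_toFormula_inputIs : Primrec fun n => (Concept.inputIs n).toFormula :=
  (Formula.primrec_restrict Ptr.inp.index).comp (Formula.primrec_and.comp
    ((Formula.primrec_restrict Ptr.hd.index).comp primrec_toFormula_number) (.const _))

theorem primrec_toFormula_treeTBox (c : Code) : Primrec fun n => (treeTBox c n).toFormula :=
  Formula.primrec_and.comp (Formula.primrec_neg.comp ((Formula.primrec_ex 0).comp
    (Formula.primrec_and.comp (.const _)
      (Formula.primrec_neg.comp Concept.primrec_toFormula_inputIs)))) (.const _)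

theorem primrec_bothFormula (c : Code) : Primrec (bothFormula c) :=
  Formula.primrec_and.comp (primrec_toFormula_treeTBox c) (.const _)

/-! ### Undecidability -/

/-- There is a program whose termination on inputs of the form `[n]` is undecidable. -/
theorem exists_undecidable_code : ∃ c : Code, ¬ ComputablePred fun n : ℕ => Terminates c [n] := by
  let f : ℕ →. ℕ := fun n => Nat.Partrec.Code.eval (Denumerable.ofNat Nat.Partrec.Code n) 0
  have hf : Partrec f :=
    Nat.Partrec.Code.eval_part.comp (Computable.ofNat Nat.Partrec.Code) (.const 0)
  obtain ⟨c, hc⟩ := Code.exists_code (Nat.Partrec'.part_iff₁.2 hf)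
  have hiff (n : ℕ) : Terminates c [n] ↔ (f n).Dom := by
    have h : c.eval [n] = pure <$> f n := hc ⟨[n], rfl⟩
    constructor
    · intro ht
      have := ht.dom
      rw [h] at this
      exact this
    · intro hd
      have : (c.eval [n]).Dom := by
        rw [h]
        exact hd
      exact terminates_of_mem (Part.get_mem this)
  refine ⟨c, fun h => ComputablePred.halting_problem 0 ?_⟩
  refine ComputablePred.computable_of_manyOneReducible (q := fun n : ℕ => Terminates c [n])
    ⟨Encodable.encode, Computable.encode, fun a => ?_⟩ h
  refine Iff.trans ?_ (hiff (Encodable.encode a)).symm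
  change (a.eval 0).Dom ↔ ((Denumerable.ofNat Nat.Partrec.Code (Encodable.encode a)).eval 0).Dom
  rw [Denumerable.ofNat_encode]

theorem not_decidableOn_of_reduction {α : Type} [Primcodable α] {D P : α → Prop} {K : ℕ → Prop}
    (hK : ¬ ComputablePred K) {g : ℕ → α} (hg : Primrec g) (hD : ∀ n, D (g n))
    (h : ∀ n, P (g n) ↔ ¬ K n) : ¬ DecidableOn D P := by
  rintro ⟨f, hf, hfD⟩
  choose b hb hbP using fun n => hfD (g n) (hD n)
  have hcomp : Computable b := (hf.comp hg.to_comp).of_eq_tot hb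
  refine hK ?_
  have hnot : ComputablePred fun n => ¬ K n :=
    ComputablePred.computable_iff.2 ⟨b, hcomp,
      funext fun n => propext ((h n).symm.trans (hbP n).symm)⟩
  exact hnot.not.of_eq fun n => not_not

end FOFrag

theorem mainTheorem3 :
    (∀ F : Set FOFrag.Formula, FOFrag.FO2 ⊆ F →
      -- conservative extensions
      (¬ FOFrag.DecidableOn
          (fun a : FOFrag.Formula × FOFrag.Formula =>
            FOFrag.IsSentenceOf F a.1 ∧ FOFrag.IsSentenceOf F a.2)
          (fun a => FOFrag.ConservativeExt F a.1 a.2)) ∧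
      -- inseparability with respect to a signature
      (¬ FOFrag.DecidableOn
          (fun a : List FOFrag.Predicate × FOFrag.Formula × FOFrag.Formula =>
            FOFrag.IsSentenceOf F a.2.1 ∧ FOFrag.IsSentenceOf F a.2.2)
          (fun a => FOFrag.SigInseparable F a.1.toFinset a.2.1 a.2.2)) ∧
      -- entailment with respect to a signature
      (¬ FOFrag.DecidableOn
          (fun a : List FOFrag.Predicate × FOFrag.Formula × FOFrag.Formula =>
            FOFrag.IsSentenceOf F a.2.1 ∧ FOFrag.IsSentenceOf F a.2.2)
          (fun a => FOFrag.SigEntails F a.1.toFinset a.2.1 a.2.2)) ∧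
      -- strong entailment with respect to a signature
      (¬ FOFrag.DecidableOn
          (fun a : List FOFrag.Predicate × FOFrag.Formula × FOFrag.Formula =>
            FOFrag.IsSentenceOf F a.2.1 ∧ FOFrag.IsSentenceOf F a.2.2)
          (fun a => FOFrag.StronglySigEntails F a.1.toFinset a.2.1 a.2.2))) ∧
    -- two-variable conservative extensions of ALC TBoxes
    ¬ ComputablePred
        (fun a : FOFrag.TBox × FOFrag.TBox =>
          FOFrag.TBox.ConservativeExt FOFrag.FO2 a.1 a.2) := by
  open FOFrag in
  obtain ⟨c, hc⟩ := exists_undecidable_code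
  have hsig (n : ℕ) : (baseTBox c).sig.toList.toFinset = (treeTBox c n).sig := by
    rw [Finset.toList_toFinset, sig_treeTBox]
  -- the common instance of the three problems that come with a signature
  have hinst : Primrec fun n =>
      ((baseTBox c).sig.toList, (treeTBox c n).toFormula, bothFormula c n) :=
    .pair (.const _) (.pair (primrec_toFormula_treeTBox c) (primrec_bothFormula c))
  refine ⟨fun F hF => ⟨?_, ?_, ?_, ?_⟩, fun h => ?_⟩
  · exact not_decidableOn_of_reduction hc
      (.pair (primrec_toFormula_treeTBox c) (.const (failTBox c).toFormula))
      (fun n => ⟨TBox.isSentenceOf_toFormula hF _, TBox.isSentenceOf_toFormula hF _⟩)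
      (conservativeExt_iff hF c)
  · refine not_decidableOn_of_reduction hc hinst
      (fun n => ⟨TBox.isSentenceOf_toFormula hF _, isSentenceOf_bothFormula hF c n⟩) fun n => ?_
    simp only [hsig n]
    exact sigInseparable_iff hF c n
  · refine not_decidableOn_of_reduction hc hinst
      (fun n => ⟨TBox.isSentenceOf_toFormula hF _, isSentenceOf_bothFormula hF c n⟩) fun n => ?_
    simp only [hsig n]
    exact sigEntails_iff hF c n
  · refine not_decidableOn_of_reduction hc hinst
      (fun n => ⟨TBox.isSentenceOf_toFormula hF _, isSentenceOf_bothFormula hF c n⟩) fun n => ?_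
    simp only [hsig n]
    exact stronglySigEntails_iff hF c n
  · have hred : ComputablePred fun n : ℕ => ¬ Terminates c [n] :=
      ComputablePred.computable_of_manyOneReducible
        ⟨_, ((primrec_treeTBox c).pair (.const (failTBox c))).to_comp,
          fun n => (conservativeExt_tbox_iff c n).symm⟩ h
    exact hc (hred.not.of_eq fun n => not_not)
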